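/- Let $H$ be a finitely generated group, let $\varphi\colon H\to B$ be an isomorphism from $H$ onto a (not necessarily proper) subgroup $B\le H$, and let \[ G=\langle H,t \mid t^{-1}at=\varphi(a)\ (a\in H)\rangle \] be the corresponding ascending HNN-extension, i.e. the quotient of the free product $H*\langle t\rangle$, with $\langle t\rangle\cong\mathbb Z$, by the normal closure of the elements $t^{-1}at\,\varphi(a)^{-1}$, $a\in H$. Then the word problem for $G$ is logspace many-one reducible to the compressed word problem for $H$, for every choice of finite symmetric generating sets $\Gamma$ of $G$ and $\Sigma$ of $H$. Here a finite generating set is symmetric if it is closed under inverses. The word problem for $G$ with respect to $\Gamma$ is the set of all words $w\in\Gamma^*$ that represent $1$ in $G$. A straight-line program over $\Sigma$ consists of a finite set $V$ of variables (disjoint from $\Sigma$), a start variable $S_0\in V$, and a map $\rho\colon V\to(V\cup\Sigma)^*$ such that the relation "$Y$ occurs in $\rho(X)$" on $V$ is acyclic; it defines the word $\mathrm{val}(S_0)\in\Sigma^*$, where $\mathrm{val}\colon(V\cup\Sigma)^*\to\Sigma^*$ is the unique monoid homomorphism with $\mathrm{val}(a)=a$ for $a\in\Sigma$ and $\mathrm{val}(X)=\mathrm{val}(\rho(X))$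 for $X\in V$. The compressed word problem for $H$ with respect to $\Sigma$ is the set of all strings (over a fixed finite alphabet) that encode a straight-line program over $\Sigma$ whose word represents $1$ in $H$. A language $K$ is logspace many-one reducible to a language $L$ if there is a function $f$, computable by a deterministic Turing machine with a read-only input tape, a write-only output tape and work space $O(\log n)$ on inputs of length $n$, such that $x\in K\Leftrightarrow f(x)\in L$ for all $x$. -/

import Mathlib

universe u v

/-! ### Word problem, ascending HNN-extensions -/

/-- `S` is a finite symmetric generating set of the group `G`. -/
structure IsSymmGenSet {G : Type u} [Group G] (S : Finset G) : Prop where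
  closure_eq_top : Subgroup.closure (S : Set G) = ⊤
  inv_mem : ∀ a ∈ S, a⁻¹ ∈ S

/-- The group element represented by a word over `S ⊆ G`. -/
def wordValue {G : Type u} [Group G] (S : Finset G) (w : List S) : G :=
  (w.map Subtype.val).prod

/-- The word problem for `G` with respect to `S`: the words over `S` that represent `1`. -/
def wordProblem {G : Type u} [Group G] (S : Finset G) : Language S :=
  {w | wordValue S w = 1}

/-- The ascending HNN-extension `⟨H, t ∣ t⁻¹ a t = φ(a) (a ∈ H)⟩`, where `φ` is an isomorphism of
`H` onto a subgroup `B` of `H`. Mathlib's `HNNExtension G A B ψ` imposes `t a = ψ(a) t` for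
`a ∈ A`, so it is used here with the isomorphism `φ⁻¹ : B → H`. -/
abbrev AscendingHNN (H : Type u) [Group H] (B : Subgroup H) (φ : H ≃* B) : Type u :=
  HNNExtension H B ⊤ (φ.symm.trans Subgroup.topEquiv.symm)

theorem AscendingHNN.conj_eq (H : Type u) [Group H] (B : Subgroup H) (φ : H ≃* B) (a : H) :
    (HNNExtension.t : AscendingHNN H B φ)⁻¹ * HNNExtension.of a * HNNExtension.t =
      HNNExtension.of (φ a : H) := by
  have h := HNNExtension.t_mul_of (φ := φ.symm.trans Subgroup.topEquiv.symm) (φ a)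
  have h2 : ((φ.symm.trans Subgroup.topEquiv.symm (φ a) : (⊤ : Subgroup H)) : H) = a := by
    rw [MulEquiv.trans_apply, MulEquiv.symm_apply_apply]; rfl
  rw [h2] at h
  rw [mul_assoc, ← h, inv_mul_cancel_left]

/-! ### Straight-line programs and the compressed word problem -/

/-- A straight-line program over the alphabet `A` with set of variables `V`. -/
structure SLP (V : Type v) (A : Type u) where
  start : V
  /-- the right-hand sides -/
  rho : V → List (V ⊕ A)
  acyclic : ∀ X, ¬ Relation.TransGen (fun X Y => Sum.inl Y ∈ rho X) X X

namespace SLP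

variable {V : Type v} {A : Type u}

theorem wellFounded [Finite V] (P : SLP V A) :
    WellFounded (fun Y X : V => Sum.inl Y ∈ P.rho X) := by
  have h : WellFounded (fun Y X : V =>
      Relation.TransGen (fun X Y => Sum.inl Y ∈ P.rho X) X Y) := by
    have : IsTrans V (fun Y X : V =>
        Relation.TransGen (fun X Y => Sum.inl Y ∈ P.rho X) X Y) :=
      ⟨fun _ _ _ h₁ h₂ => h₂.trans h₁⟩
    have : Std.Irrefl (fun Y X : V =>
        Relation.TransGen (fun X Y => Sum.inl Y ∈ P.rho X) X Y) := ⟨P.acyclic⟩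
    exact Finite.wellFounded_of_trans_of_irrefl _
  exact Subrelation.wf (fun h => Relation.TransGen.single h) h

/-- The word produced by a variable: substitute recursively in its right-hand side. -/
noncomputable def valVar [Finite V] (P : SLP V A) : V → List A :=
  P.wellFounded.fix fun X ih =>
    (P.rho X).attach.flatMap fun s =>
      match s with
      | ⟨Sum.inl Y, h⟩ => ih Y h
      | ⟨Sum.inr a, _⟩ => [a]

/-- `valVar` satisfies `val(X) = val(ρ(X))`. -/
theorem valVar_eq [Finite V] (P : SLP V A) (X : V) :
    P.valVar X = (P.rho X).flatMap (Sum.elim P.valVar fun a => [a]) := by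
  conv_lhs => rw [valVar, WellFounded.fix_eq]
  conv_rhs => rw [← List.attach_map_subtype_val (P.rho X), List.flatMap_map]
  congr 1
  funext s
  rcases s with ⟨Y | a, h⟩ <;> rfl

/-- The word defined by a straight-line program. -/
noncomputable def val [Finite V] (P : SLP V A) : List A :=
  P.valVar P.start

end SLP

/-- The symbols used to write down a straight-line program over `A` as a string. -/
inductive SLPSymbol (A : Type u) : Type u
  | letter (a : A)
  | var
  | one
  | sep

instance {A : Type u} [Finite A] : Finite (SLPSymbol A) := by
  have h : Function.Surjective (fun o : Option (Option (Option A)) =>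
      match o with
      | none => SLPSymbol.var
      | some none => SLPSymbol.one
      | some (some none) => SLPSymbol.sep
      | some (some (some a)) => SLPSymbol.letter a) := by
    intro s
    cases s with
    | letter a => exact ⟨some (some (some a)), rfl⟩
    | var => exact ⟨none, rfl⟩
    | one => exact ⟨some none, rfl⟩
    | sep => exact ⟨some (some none), rfl⟩
  exact Finite.of_surjective _ h

namespace SLP

variable {A : Type u} {n : ℕ}

/-- The name of the variable number `i`: the symbol `var` followed by `i` in unary. As `i` is less
than the number of variables, every one of which has its own rule in the string, unary and binary
names can be transformed into each other in logarithmic space. -/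
def encodeVar (i : Fin n) : List (SLPSymbol A) :=
  SLPSymbol.var :: List.replicate i SLPSymbol.one

/-- A right-hand side, closed by `sep`. -/
def encodeRhs (r : List (Fin n ⊕ A)) : List (SLPSymbol A) :=
  r.flatMap (Sum.elim encodeVar fun a => [SLPSymbol.letter a]) ++ [SLPSymbol.sep]

/-- The string for a straight-line program with variables `0, …, n - 1`: the start variable, closed
by `sep`, then the right-hand sides of the variables `0, …, n - 1` in this order. -/
def encode (P : SLP (Fin n) A) : List (SLPSymbol A) :=
  encodeVar P.start ++ SLPSymbol.sep :: (List.finRange n).flatMap fun X => encodeRhs (P.rho X)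

end SLP

/-- The compressed word problem for `G` with respect to `S`: the strings that encode a straight-line
program over `S` whose word represents `1`. -/
def compressedWordProblem {G : Type u} [Group G] (S : Finset G) : Language (SLPSymbol S) :=
  {x | ∃ (n : ℕ) (P : SLP (Fin n) S), x = P.encode ∧ wordValue S P.val = 1}

/-! ### Logspace reductions -/

/-- Head movements. -/
inductive Move
  | left
  | stay
  | right

/-- The contents of an input cell: the input is placed between two end markers. -/
inductive InCell (α : Type u) : Type u
  | leftEnd
  | letter (a : α)
  | rightEnd

/-- A deterministic Turing machine with a two-way read-only input tape, `tapes` many one-sided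
infinite work tapes and a write-only output tape. In one step, the new state, the moves of all
heads, the letters written on the work tapes, and the (possibly empty) word appended to the output
depend on the state and the scanned cells; `none` means that the machine halts. -/
structure Transducer (α : Type u) (β : Type v) [Finite α] [Finite β] where
  State : Type
  finite_state : Finite State
  Work : Type
  finite_work : Finite Work
  tapes : ℕ
  start : State
  blank : Work
  trans : State → InCell α → (Fin tapes → Work) →
    Option (State × Move × (Fin tapes → Work × Move) × List β)

namespace Transducer

variable {α : Type u} {β : Type v} [Finite α] [Finite β]

/-- Configurations. The input `x` occupies the cells `1, …, x.length` of the input tape. -/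
structure Cfg (M : Transducer α β) where
  state : M.State
  inHead : ℕ
  work : Fin M.tapes → ℕ → M.Work
  workHead : Fin M.tapes → ℕ
  out : List β

/-- The input cell at position `p`. -/
def inCell (x : List α) : ℕ → InCell α
  | 0 => InCell.leftEnd
  | p + 1 =>
    match x[p]? with
    | some a => InCell.letter a
    | none => InCell.rightEnd

/-- A work head cannot move to the left of cell `0`. -/
def moveWork : Move → ℕ → ℕ
  | Move.left, p => p - 1
  | Move.stay, p => p
  | Move.right, p => p + 1

/-- The input head stays between the end markers at the cells `0` and `x.length + 1`. -/
def moveIn (x : List α) (m : Move) (p : ℕ) : ℕ :=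
  min (moveWork m p) (x.length + 1)

def init (M : Transducer α β) : M.Cfg where
  state := M.start
  inHead := 0
  work := fun _ _ => M.blank
  workHead := fun _ => 0
  out := []

/-- One step on input `x`. -/
def step (M : Transducer α β) (x : List α) (c : M.Cfg) : Option M.Cfg :=
  (M.trans c.state (inCell x c.inHead) fun i => c.work i (c.workHead i)).map
    fun ⟨q, m, w, o⟩ =>
      { state := q
        inHead := moveIn x m c.inHead
        work := fun i => Function.update (c.work i) (c.workHead i) (w i).1
        workHead := fun i => moveWork (w i).2 (c.workHead i)
        out := c.out ++ o }

/-- On input `x`, the machine halts with output `y`. -/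
def HaltsWith (M : Transducer α β) (x : List α) (y : List β) : Prop :=
  ∃ c, StateTransition.Reaches (M.step x) M.init c ∧ M.step x c = none ∧ c.out = y

/-- On input `x`, no work head ever leaves the cells `0, …, s`. -/
def UsesSpaceAtMost (M : Transducer α β) (x : List α) (s : ℕ) : Prop :=
  ∀ c, StateTransition.Reaches (M.step x) M.init c → ∀ i, c.workHead i ≤ s

end Transducer

/-- `f` is computed by a Turing machine that halts on every input and whose work space is
`O(log n)` on inputs of length `n`. -/
def LogspaceComputable {α : Type u} {β : Type v} [Finite α] [Finite β]
    (f : List α → List β) : Prop :=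
  ∃ (M : Transducer α β) (k : ℕ), ∀ x : List α,
    M.HaltsWith x (f x) ∧ M.UsesSpaceAtMost x (k * (Nat.log 2 x.length + 1))

/-- Logspace many-one reducibility. -/
def LogspaceReducible {α : Type u} {β : Type v} [Finite α] [Finite β]
    (K : Language α) (L : Language β) : Prop :=
  ∃ f : List α → List β, LogspaceComputable f ∧ ∀ x, x ∈ K ↔ f x ∈ L

/-!
Write `f` for `φ`, seen as an endomorphism of `H`. From `a t = t f(a)` it follows that a letter can
be pushed to the right through a sufficiently large negative power of `t`: for a suitable constant
`C`, every generator `g ∈ T` satisfies `t ^ (-C) * g = h_g * t ^ (d_g - C)` with `h_g ∈ H`, where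
`d_g` is the exponent sum of `g` (`AscendingHNN.exists_pushRight`). For a word `g_1 … g_n`, let
`e_i` be the exponent sum of the prefix `g_1 … g_i`, let `D` be a bound for all `|d_g|`, and put
`k_i = D n - e_i`, a natural number. Repeated pushing gives
`t ^ (-D n - C) * g_1 ⋯ g_n = f ^ k_0 (h_{g_1}) ⋯ f ^ k_{n-1} (h_{g_n}) * t ^ (-k_n - C)`.
As `H` embeds into `G`, the word represents `1` if and only if `e_n = 0` and the product of the
elements `f ^ k_{i-1} (h_{g_i})` is `1` (`AscendingHNN.wordValue_eq_one_iff`).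

This product is defined by a straight-line program with a variable for each `f ^ k (b)`, where
`b ∈ S` and `k ≤ 2 D n`: the rule for `f ^ (k + 1) (b)` is obtained from a fixed word for `f (b)`
(`Reduction.Data.slp`, `Reduction.Data.wordValue_slp`). The reduction writes down this program if
`e_n = 0`, and the empty string, which encodes no program, otherwise. Since an encoded string
determines its program (`SLP.encode_injective`), this is a many-one reduction.

The string can be written with two counters with values linear in `n`. To obtain a Turing machine,
a small language of structured programs (`Prog`) is compiled to transducers
(`Exec.reflTransGen`); programs for incrementing, decrementing and testing binary counters on work
tapes lead to a calculus for programs with counters (`Runs`), in which linearly bounded counters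
cost logarithmic space (`Prog.logspaceComputable_of_runs`). The reduction is
`Reduction.program`.
-/

/-! ### Structured programs for Turing machines -/

/-- The alphabet of the work tapes: a marker for cell `0`, the blank, and binary digits. -/
inductive TapeSym
  | mark
  | blank
  | bit (b : Bool)

instance : Finite TapeSym :=
  Finite.of_surjective
    (fun o : Option (Option Bool) =>
      o.elim TapeSym.mark fun o => o.elim TapeSym.blank TapeSym.bit) (by
      intro s
      cases s with
      | mark => exact ⟨none, rfl⟩
      | blank => exact ⟨some none, rfl⟩
      | bit b => exact ⟨some (some b), rfl⟩)

instance {α : Type u} [Finite α] : Finite (InCell α) :=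
  Finite.of_surjective
    (fun o : Option (Option α) =>
      o.elim InCell.leftEnd fun o => o.elim InCell.rightEnd InCell.letter) (by
      intro s
      cases s with
      | leftEnd => exact ⟨none, rfl⟩
      | rightEnd => exact ⟨some none, rfl⟩
      | letter a => exact ⟨some (some a), rfl⟩)

/-- The symbols scanned on the input tape and on `k` work tapes. -/
abbrev View (α : Type u) (k : ℕ) : Type u := InCell α × (Fin k → TapeSym)

/-- What one step of a machine does apart from changing the state: the move of the input head, the
letters written and the moves on the work tapes, and the word appended to the output. -/
abbrev Effect (k : ℕ) (β : Type v) : Type v := Move × (Fin k → TapeSym × Move) × List β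

/-- The effect of a step that changes nothing but the state. -/
def idle {α : Type u} {k : ℕ} (β : Type v) (w : View α k) : Effect k β :=
  (Move.stay, fun i => (w.2 i, Move.stay), [])

/-- Structured programs over `k` work tapes: a single step whose effect depends on the scanned
symbols, composition, `while`-loops and case distinctions on the scanned symbols. -/
inductive Prog (α : Type u) (β : Type v) (k : ℕ) : Type (max u v)
  | act (a : View α k → Effect k β)
  | seq (p q : Prog α β k)
  | loop (b : View α k → Bool) (p : Prog α β k)
  | branch (f : View α k → Prog α β k)

namespace Prog

variable {α : Type u} {β : Type v} {k : ℕ}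

/-- The program points, that is, the states of the machine for a program. In a loop and in a case
distinction, `none` is the point at which the scanned symbols are inspected. -/
def Point : Prog α β k → Type u
  | act _ => PUnit
  | seq p q => p.Point ⊕ q.Point
  | loop _ p => Option p.Point
  | branch f => Option (Σ w : View α k, (f w).Point)

/-- The point at which a program starts. -/
def entry : (p : Prog α β k) → p.Point
  | act _ => PUnit.unit
  | seq p _ => Sum.inl p.entry
  | loop _ _ => none
  | branch _ => none

/-- The transition function of the machine for a program; the successor `none` means that the
program is left. -/
def trans : (p : Prog α β k) → p.Point → View α k → Option p.Point × Effect k β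
  | act a, _, w => (none, a w)
  | seq p q, Sum.inl s, w =>
    (some ((p.trans s w).1.elim (Sum.inr q.entry) Sum.inl), (p.trans s w).2)
  | seq _ q, Sum.inr s, w => ((q.trans s w).1.map Sum.inr, (q.trans s w).2)
  | loop b p, none, w => (if b w then some (some p.entry) else none, idle β w)
  | loop _ p, some s, w => (some (p.trans s w).1, (p.trans s w).2)
  | branch f, none, w => (some (some ⟨w, (f w).entry⟩), idle β w)
  | branch f, some ⟨w', s⟩, w =>
    (((f w').trans s w).1.map fun s' => some ⟨w', s'⟩, ((f w').trans s w).2)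

instance finite_point [Finite α] : (p : Prog α β k) → Finite p.Point
  | act _ => inferInstanceAs (Finite PUnit)
  | seq p q =>
    have := p.finite_point
    have := q.finite_point
    inferInstanceAs (Finite (p.Point ⊕ q.Point))
  | loop _ p =>
    have := p.finite_point
    inferInstanceAs (Finite (Option p.Point))
  | branch f =>
    have := fun w => (f w).finite_point
    inferInstanceAs (Finite (Option (Σ w : View α k, (f w).Point)))

end Prog

/-- The contents of a configuration, without the state. -/
@[ext]
structure Store (k : ℕ) (β : Type v) where
  inHead : ℕ
  work : Fin k → ℕ → TapeSym
  workHead : Fin k → ℕ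
  out : List β

namespace Store

variable {α : Type u} {β : Type v} {k : ℕ}

/-- The move of the input head; for a head between the end markers it agrees with
`Transducer.moveIn`. -/
def moveHead (x : List α) : Move → ℕ → ℕ
  | Move.left, p => p - 1
  | Move.stay, p => p
  | Move.right, p => min (p + 1) (x.length + 1)

theorem moveIn_eq_moveHead (x : List α) (m : Move) {p : ℕ} (hp : p ≤ x.length + 1) :
    Transducer.moveIn x m p = moveHead x m p := by
  cases m <;> simp only [Transducer.moveIn, Transducer.moveWork, moveHead] <;> omega

theorem moveHead_le (x : List α) (m : Move) {p : ℕ} (hp : p ≤ x.length + 1) :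
    moveHead x m p ≤ x.length + 1 := by
  cases m <;> simp only [moveHead] <;> omega

/-- The symbols under the heads. -/
def view (x : List α) (d : Store k β) : View α k :=
  (Transducer.inCell x d.inHead, fun i => d.work i (d.workHead i))

/-- The store after one step. -/
def apply (x : List α) (e : Effect k β) (d : Store k β) : Store k β where
  inHead := moveHead x e.1 d.inHead
  work := fun i => Function.update (d.work i) (d.workHead i) (e.2.1 i).1
  workHead := fun i => Transducer.moveWork (e.2.1 i).2 (d.workHead i)
  out := d.out ++ e.2.2

theorem apply_idle (x : List α) (d : Store k β) : d.apply x (idle β (d.view x)) = d := by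
  ext <;> simp [apply, idle, view, moveHead, Transducer.moveWork]

end Store

/-- `Exec x s p d d'`: on input `x`, the program `p` turns the store `d` into `d'`, and no step
moves a work head beyond cell `s`. -/
inductive Exec {α : Type u} {β : Type v} {k : ℕ} (x : List α) (s : ℕ) :
    Prog α β k → Store k β → Store k β → Prop
  | act (a : View α k → Effect k β) (d : Store k β)
      (h : ∀ i, (d.apply x (a (d.view x))).workHead i ≤ s) :
      Exec x s (Prog.act a) d (d.apply x (a (d.view x)))
  | seq {p q : Prog α β k} {d d' d'' : Store k β} (hp : Exec x s p d d') (hq : Exec x s q d' d'') :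
      Exec x s (Prog.seq p q) d d''
  | loop_done {b : View α k → Bool} {p : Prog α β k} {d : Store k β} (h : b (d.view x) = false) :
      Exec x s (Prog.loop b p) d d
  | loop_step {b : View α k → Bool} {p : Prog α β k} {d d' d'' : Store k β}
      (h : b (d.view x) = true) (hp : Exec x s p d d') (hl : Exec x s (Prog.loop b p) d' d'') :
      Exec x s (Prog.loop b p) d d''
  | branch {f : View α k → Prog α β k} {d d' : Store k β} (h : Exec x s (f (d.view x)) d d') :
      Exec x s (Prog.branch f) d d'

theorem Exec.mono {α : Type u} {β : Type v} {k : ℕ} {x : List α} {s s' : ℕ} {p : Prog α β k}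
    {d d' : Store k β} (h : Exec x s p d d') (hs : s ≤ s') : Exec x s' p d d' := by
  induction h with
  | act a d h => exact Exec.act a d fun i => (h i).trans hs
  | seq _ _ ihp ihq => exact Exec.seq ihp ihq
  | loop_done h => exact Exec.loop_done h
  | loop_step h _ _ ihp ihl => exact Exec.loop_step h ihp ihl
  | branch _ ih => exact Exec.branch ih

namespace Prog

variable {α : Type u} {β : Type v} {k : ℕ} [Finite α] [Finite β]

/-- A transducer with work alphabet `TapeSym`, given by a transition function on views. -/
abbrev mkTransducer {Q : Type} [Finite Q] (start : Q)
    (tr : Q → View α k → Option (Q × Effect k β)) : Transducer α β where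
  State := Q
  finite_state := inferInstance
  Work := TapeSym
  finite_work := inferInstance
  tapes := k
  start := start
  blank := TapeSym.blank
  trans := fun q a w => tr q (a, w)

/-- The configuration with given state and store. -/
abbrev cfg {Q : Type} [Finite Q] {start : Q} {tr : Q → View α k → Option (Q × Effect k β)}
    (q : Q) (d : Store k β) : (mkTransducer start tr).Cfg :=
  ⟨q, d.inHead, d.work, d.workHead, d.out⟩

/-- A step after which no work head is beyond cell `s`. -/
def BoundedStep (M : Transducer α β) (x : List α) (s : ℕ) (c c' : M.Cfg) : Prop :=
  c' ∈ M.step x c ∧ ∀ i, c'.workHead i ≤ s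

theorem boundedStep_cfg {Q : Type} [Finite Q] {start : Q}
    {tr : Q → View α k → Option (Q × Effect k β)} {x : List α} {s : ℕ} {q q' : Q}
    {d : Store k β} {e : Effect k β} (hd : d.inHead ≤ x.length + 1)
    (h : tr q (d.view x) = some (q', e)) (hs : ∀ i, (d.apply x e).workHead i ≤ s) :
    BoundedStep (mkTransducer start tr) x s (cfg q d) (cfg q' (d.apply x e)) := by
  refine ⟨?_, hs⟩
  have h' : tr q (Transducer.inCell x d.inHead, fun i => d.work i (d.workHead i)) =
    some (q', e) := h
  simp only [Transducer.step, h', Option.map_some, Option.mem_def,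
    Store.moveIn_eq_moveHead x _ hd]
  rfl

/-- A machine that contains the transitions of the program `p`, with `emb` for the program points
and `exit` for the state after `p`, carries out every execution of `p`. -/
theorem _root_.Exec.reflTransGen {Q : Type} [Finite Q] {start : Q}
    {tr : Q → View α k → Option (Q × Effect k β)} {x : List α} {s : ℕ} {p : Prog α β k}
    {d d' : Store k β} (h : Exec x s p d d') (exit : Q) (emb : p.Point → Q)
    (htr : ∀ σ w, tr (emb σ) w = some ((p.trans σ w).1.elim exit emb, (p.trans σ w).2))
    (hd : d.inHead ≤ x.length + 1) (hs : ∀ i, d.workHead i ≤ s) :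
    d'.inHead ≤ x.length + 1 ∧ (∀ i, d'.workHead i ≤ s) ∧
      Relation.ReflTransGen (BoundedStep (mkTransducer start tr) x s)
        (cfg (emb p.entry) d) (cfg exit d') := by
  induction h generalizing exit with
  | act a d h =>
    exact ⟨Store.moveHead_le x _ hd, h, .single (boundedStep_cfg hd (htr _ _) h)⟩
  | @seq p q d d' d'' hp hq ihp ihq =>
    obtain ⟨h1, h2, h3⟩ := ihp (emb (Sum.inr q.entry)) (fun σ => emb (Sum.inl σ)) (fun σ w => by
      refine (htr _ w).trans ?_
      dsimp only [trans]
      cases (p.trans σ w).1 <;> rfl) hd hs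
    obtain ⟨h4, h5, h6⟩ := ihq exit (fun σ => emb (Sum.inr σ)) (fun σ w => by
      refine (htr _ w).trans ?_
      dsimp only [trans]
      cases (q.trans σ w).1 <;> rfl) h1 h2
    exact ⟨h4, h5, h3.trans h6⟩
  | @loop_done b p d h =>
    refine ⟨hd, hs, .single ?_⟩
    have := boundedStep_cfg (start := start) (tr := tr) (x := x) (s := s) (q := emb none)
      (q' := exit) (e := idle β (d.view x)) hd ((htr none _).trans (by simp [trans, h]))
      (by rw [Store.apply_idle]; exact hs)
    rwa [Store.apply_idle] at this
  | @loop_step b p d d' d'' h hp hl ihp ihl =>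
    obtain ⟨h1, h2, h3⟩ := ihp (emb none) (fun σ => emb (some σ)) (fun σ w => by
      refine (htr _ w).trans ?_
      dsimp only [trans]
      cases (p.trans σ w).1 <;> rfl) hd hs
    obtain ⟨h4, h5, h6⟩ := ihl exit emb htr h1 h2
    refine ⟨h4, h5, .head ?_ (h3.trans h6)⟩
    have := boundedStep_cfg (start := start) (tr := tr) (x := x) (s := s) (q := emb none)
      (q' := emb (some p.entry)) (e := idle β (d.view x)) hd
      ((htr none _).trans (by simp only [trans, h, if_true]; rfl))
      (by rw [Store.apply_idle]; exact hs)
    rwa [Store.apply_idle] at this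
  | @branch f d d' h ih =>
    obtain ⟨h1, h2, h3⟩ := ih exit (fun σ => emb (some ⟨d.view x, σ⟩)) (fun σ w => by
      refine (htr _ w).trans ?_
      dsimp only [trans]
      cases ((f (d.view x)).trans σ w).1 <;> rfl) hd hs
    refine ⟨h1, h2, .head ?_ h3⟩
    have := boundedStep_cfg (start := start) (tr := tr) (x := x) (s := s) (q := emb none)
      (q' := emb (some ⟨d.view x, (f (d.view x)).entry⟩)) (e := idle β (d.view x)) hd
      (htr none _)
      (by rw [Store.apply_idle]; exact hs)
    rwa [Store.apply_idle] at this

/-- As machines are deterministic, the space bound along one halting run covers every reachable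
configuration. -/
theorem workHead_le_of_reaches {M : Transducer α β} {x : List α} {s : ℕ} {c c' : M.Cfg}
    (h : Relation.ReflTransGen (BoundedStep M x s) c c') (hc' : M.step x c' = none)
    (hc : ∀ i, c.workHead i ≤ s) (e : M.Cfg) (he : StateTransition.Reaches (M.step x) c e)
    (i : Fin M.tapes) : e.workHead i ≤ s := by
  induction h using Relation.ReflTransGen.head_induction_on with
  | refl =>
    rcases Relation.ReflTransGen.cases_head he with rfl | ⟨b, hb, -⟩
    · exact hc i
    · simp [hc'] at hb
  | head h1 _ ih =>
    rcases Relation.ReflTransGen.cases_head he with rfl | ⟨b, hb, hbe⟩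
    · exact hc i
    · obtain rfl := Option.mem_unique hb h1.1
      exact ih h1.2 hbe

/-- The store in which a machine starts. -/
def initStore : Store k β := ⟨0, fun _ _ => TapeSym.blank, fun _ => 0, []⟩

theorem logspaceComputable_of_exec (p : Prog α β k) (f : List α → List β) (c : ℕ)
    (h : ∀ x, ∃ d, Exec x (c * (Nat.log 2 x.length + 1)) p initStore d ∧ d.out = f x) :
    LogspaceComputable f := by
  obtain ⟨n, ⟨e⟩⟩ := Finite.exists_equiv_fin (Option p.Point)
  let tr : Fin n → View α k → Option (Fin n × Effect k β) := fun q w =>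
    (e.symm q).map fun σ => ((p.trans σ w).1.elim (e none) (fun σ => e (some σ)), (p.trans σ w).2)
  refine ⟨mkTransducer (e (some p.entry)) tr, c, fun x => ?_⟩
  obtain ⟨d, hd, hout⟩ := h x
  obtain ⟨-, -, h3⟩ := hd.reflTransGen (start := e (some p.entry)) (tr := tr) (e none)
    (fun σ => e (some σ)) (fun σ w => by simp [tr]) (Nat.zero_le _) (fun _ => Nat.zero_le _)
  have hhalt : (mkTransducer (e (some p.entry)) tr).step x (cfg (e none) d) = none := by
    simp [Transducer.step, tr]
  exact ⟨⟨_,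
    Relation.ReflTransGen.mono (fun _ _ h => h.1) _ _ h3, hhalt, hout⟩,
    workHead_le_of_reaches h3 hhalt fun _ => Nat.zero_le _⟩

end Prog

/-! ### Binary counters on work tapes -/

/-- The value of a list of binary digits, least significant digit first. -/
def digitsValue : List Bool → ℕ
  | [] => 0
  | b :: L => b.toNat + 2 * digitsValue L

/-- Addition of `1` to a list of binary digits. -/
def incDigits : List Bool → List Bool
  | [] => [true]
  | false :: L => true :: L
  | true :: L => false :: incDigits L

theorem digitsValue_incDigits (L : List Bool) :
    digitsValue (incDigits L) = digitsValue L + 1 := by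
  induction L with
  | nil => rfl
  | cons b L ih =>
    cases b
    · simp [incDigits, digitsValue]; omega
    · simp [incDigits, digitsValue, ih]; omega

theorem length_incDigits_le (L : List Bool) :
    (incDigits L).length ≤ max L.length (Nat.log 2 (digitsValue (incDigits L)) + 1) := by
  have h : (incDigits L).length = L.length ∨ 2 ^ L.length ≤ digitsValue (incDigits L) ∧
      (incDigits L).length = L.length + 1 := by
    induction L with
    | nil => exact Or.inr ⟨le_rfl, rfl⟩
    | cons b L ih =>
      cases b
      · exact Or.inl rfl
      · rcases ih with ih | ⟨ih, ih'⟩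
        · exact Or.inl (by simp [incDigits, ih])
        · refine Or.inr ⟨?_, by simp [incDigits, ih']⟩
          simp only [incDigits, digitsValue, List.length_cons, pow_succ, Bool.toNat_false]
          omega
  rcases h with h | ⟨h, h'⟩
  · omega
  · have := Nat.le_log_of_pow_le (b := 2) (by norm_num) h
    omega

theorem digitsValue_replicate_false (j : ℕ) : digitsValue (List.replicate j false) = 0 := by
  induction j with
  | zero => rfl
  | succ j ih => simp [List.replicate_succ, digitsValue, ih]

theorem digitsValue_borrow (j : ℕ) (L : List Bool) :
    digitsValue (List.replicate j false ++ true :: L) =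
      digitsValue (List.replicate j true ++ false :: L) + 1 := by
  induction j with
  | zero => simp [digitsValue]; omega
  | succ j ih =>
    simp only [List.replicate_succ, List.cons_append, digitsValue, ih, Bool.toNat_false,
      Bool.toNat_true]
    omega

theorem eq_replicate_false_or (L : List Bool) :
    (∃ j, L = List.replicate j false) ∨ ∃ j L', L = List.replicate j false ++ true :: L' := by
  induction L with
  | nil => exact Or.inl ⟨0, rfl⟩
  | cons b L ih =>
    cases b
    · rcases ih with ⟨j, rfl⟩ | ⟨j, L', rfl⟩
      · exact Or.inl ⟨j + 1, rfl⟩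
      · exact Or.inr ⟨j + 1, L', rfl⟩
    · exact Or.inr ⟨0, L, rfl⟩

/-- The work tape holding a list of digits in the cells `1, 2, …`. -/
def digitTape (L : List Bool) : ℕ → TapeSym
  | 0 => TapeSym.mark
  | p + 1 => (L[p]?).elim TapeSym.blank TapeSym.bit

theorem digitTape_append_cons (L L' : List Bool) (b : Bool) :
    digitTape (L ++ b :: L') (L.length + 1) = TapeSym.bit b := by
  simp [digitTape]

theorem digitTape_length (L : List Bool) : digitTape L (L.length + 1) = TapeSym.blank := by
  simp [digitTape]

theorem update_digitTape_append_cons (L L' : List Bool) (b b' : Bool) :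
    Function.update (digitTape (L ++ b :: L')) (L.length + 1) (TapeSym.bit b') =
      digitTape (L ++ b' :: L') := by
  funext p
  rcases p with _ | p
  · rfl
  rcases lt_trichotomy p L.length with h | rfl | h
  · rw [Function.update_of_ne (by omega)]
    simp [digitTape, List.getElem?_append_left h]
  · simp [digitTape]
  · rw [Function.update_of_ne (by omega)]
    obtain ⟨q, rfl⟩ := Nat.exists_eq_add_of_lt h
    simp only [digitTape, List.getElem?_append_right h.le]
    simp [Nat.add_assoc]

theorem update_digitTape_length (L : List Bool) (b : Bool) :
    Function.update (digitTape L) (L.length + 1) (TapeSym.bit b) = digitTape (L ++ [b]) := by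
  funext p
  rcases p with _ | p
  · rfl
  rcases lt_trichotomy p L.length with h | rfl | h
  · rw [Function.update_of_ne (by omega)]
    simp [digitTape, List.getElem?_append_left h]
  · simp [digitTape]
  · rw [Function.update_of_ne (by omega)]
    obtain ⟨q, rfl⟩ := Nat.exists_eq_add_of_lt h
    simp [digitTape, Nat.add_assoc]

namespace TapeSym

def isBit (b : Bool) : TapeSym → Bool
  | mark => false
  | blank => false
  | bit c => b == c

def isMark : TapeSym → Bool
  | mark => true
  | blank => false
  | bit _ => false

end TapeSym

namespace Store

variable {α : Type u} {β : Type v} {k : ℕ}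

/-- Replace work tape `i` by the tape with digits `L` and head at cell `n`. -/
def setTape (d : Store k β) (i : Fin k) (L : List Bool) (n : ℕ) : Store k β :=
  { d with
    work := Function.update d.work i (digitTape L)
    workHead := Function.update d.workHead i n }

theorem view_setTape (x : List α) (d : Store k β) (i : Fin k) (L : List Bool) (n : ℕ) :
    ((d.setTape i L n).view x).2 i = digitTape L n := by
  simp [view, setTape]

/-- All work tapes hold counters, with their heads at cell `0`. -/
def counters (pos : ℕ) (L : Fin k → List Bool) (out : List β) : Store k β :=
  ⟨pos, fun i => digitTape (L i), fun _ => 0, out⟩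

theorem setTape_counters (pos : ℕ) (L : Fin k → List Bool) (out : List β) (i : Fin k)
    (L' : List Bool) :
    (counters pos L out).setTape i L' 0 = counters pos (Function.update L i L') out := by
  ext1
  · rfl
  · funext j
    rcases eq_or_ne j i with rfl | h <;> simp [setTape, counters, *]
  · funext j
    rcases eq_or_ne j i with rfl | h <;> simp [setTape, counters, *]
  · rfl

end Store

namespace Prog

variable {α : Type u} {β : Type v} {k : ℕ}

/-- Rewrite the scanned symbol of tape `i` by `g` and move the head of this tape. -/
def tapeAct (i : Fin k) (g : TapeSym → TapeSym) (m : Move) : Prog α β k :=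
  act fun w => (Move.stay,
    Function.update (fun j => (w.2 j, Move.stay)) i (g (w.2 i), m), [])

/-- Return to the marker in cell `0` of tape `i`. -/
def rewind (i : Fin k) : Prog α β k :=
  loop (fun w => !(w.2 i).isMark) (tapeAct i id Move.left)

/-- Increment the counter on tape `i`, whose head starts and ends at cell `0`. -/
def inc (i : Fin k) : Prog α β k :=
  seq (tapeAct i id Move.right) <|
  seq (loop (fun w => (w.2 i).isBit true)
    (tapeAct i (fun _ => TapeSym.bit false) Move.right)) <|
  seq (tapeAct i (fun _ => TapeSym.bit true) Move.left) (rewind i)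

/-- From cell `0`, move to the lowest digit `1`, or to the first blank if there is none. -/
def scan (i : Fin k) : Prog α β k :=
  seq (tapeAct i id Move.right)
    (loop (fun w => (w.2 i).isBit false) (tapeAct i id Move.right))

/-- From the lowest digit `1`, decrement the counter and return to cell `0`. -/
def borrow (i : Fin k) : Prog α β k :=
  seq (tapeAct i (fun _ => TapeSym.bit false) Move.left)
    (loop (fun w => !(w.2 i).isMark) (tapeAct i (fun _ => TapeSym.bit true) Move.left))

/-- While counter `i` is positive, decrement it and run `p`. -/
def whilePos (i : Fin k) (p : Prog α β k) : Prog α β k :=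
  seq (scan i) <|
  seq (loop (fun w => (w.2 i).isBit true) (seq (borrow i) (seq p (scan i)))) (rewind i)

/-- If counter `i` is positive, decrement it and run `p`, otherwise run `q`. -/
def ifPos (i : Fin k) (p q : Prog α β k) : Prog α β k :=
  seq (scan i) <|
  branch fun w => if (w.2 i).isBit true then seq (borrow i) p else seq (rewind i) q

variable {x : List α} {s : ℕ} {d : Store k β} {i : Fin k}

theorem exec_tapeAct {L L' : List Bool} {n : ℕ} {g : TapeSym → TapeSym} {m : Move}
    (hs : ∀ j, d.workHead j ≤ s) (hn : Transducer.moveWork m n ≤ s)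
    (h : Function.update (digitTape L) n (g (digitTape L n)) = digitTape L') :
    Exec x s (tapeAct i g m) (d.setTape i L n)
      (d.setTape i L' (Transducer.moveWork m n)) := by
  have key : (d.setTape i L n).apply x ((Move.stay,
      Function.update (fun j => (((d.setTape i L n).view x).2 j, Move.stay)) i
        (g (((d.setTape i L n).view x).2 i), m), [])) =
      d.setTape i L' (Transducer.moveWork m n) := by
    ext1
    · rfl
    · funext j
      rcases eq_or_ne j i with rfl | hj
      · simp [Store.apply, Store.view, Store.setTape, h]
      · simp [Store.apply, Store.view, Store.setTape, hj]
    · funext j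
      rcases eq_or_ne j i with rfl | hj
      · simp [Store.apply, Store.setTape]
      · simp [Store.apply, Store.setTape, hj, Transducer.moveWork]
    · simp [Store.apply, Store.setTape]
  have := Exec.act (x := x) (s := s) (fun w : View α k => ((Move.stay,
    Function.update (fun j => (w.2 j, Move.stay)) i (g (w.2 i), m), []) : Effect k β))
    (d.setTape i L n)
  rw [key] at this
  refine this fun j => ?_
  rcases eq_or_ne j i with rfl | hj
  · simpa [Store.setTape] using hn
  · simpa [Store.setTape, hj] using hs j

theorem exec_tapeMove {L : List Bool} {n : ℕ} {m : Move}
    (hs : ∀ j, d.workHead j ≤ s) (hn : Transducer.moveWork m n ≤ s) :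
    Exec x s (tapeAct i id m) (d.setTape i L n) (d.setTape i L (Transducer.moveWork m n)) :=
  exec_tapeAct hs hn (Function.update_eq_self _ _)

theorem exec_rewind {L : List Bool} {n : ℕ} (hs : ∀ j, d.workHead j ≤ s) (hn : n ≤ s) :
    Exec x s (rewind i) (d.setTape i L n) (d.setTape i L 0) := by
  induction n with
  | zero => exact Exec.loop_done (by rw [Store.view_setTape]; rfl)
  | succ n ih =>
    refine Exec.loop_step ?_
      (exec_tapeMove (m := Move.left) hs (by simp [Transducer.moveWork]; omega)) (ih (by omega))
    rw [Store.view_setTape]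
    simp only [digitTape]
    cases L[n]? <;> rfl

theorem exec_inc {L : List Bool} (hs : ∀ j, d.workHead j ≤ s) (hL : L.length + 1 ≤ s) :
    Exec x s (inc i) (d.setTape i L 0) (d.setTape i (incDigits L) 0) := by
  -- the carry has passed the digits `pre` and is about to enter `suf`
  have key : ∀ suf pre : List Bool, pre.length + suf.length + 1 ≤ s →
      Exec x s (seq (loop (fun w => (w.2 i).isBit true)
        (tapeAct i (fun _ => TapeSym.bit false) Move.right)) <|
        seq (tapeAct i (fun _ => TapeSym.bit true) Move.left) (rewind i))
        (d.setTape i (pre ++ suf) (pre.length + 1))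
        (d.setTape i (pre ++ incDigits suf) 0) := by
    intro suf
    induction suf with
    | nil =>
      intro pre hpre
      simp only [List.length_nil] at hpre
      refine Exec.seq (Exec.loop_done ?_) (Exec.seq (exec_tapeAct hs ?_ ?_)
        (exec_rewind hs (n := pre.length) (by omega)))
      · rw [Store.view_setTape, List.append_nil, digitTape_length]; rfl
      · simp only [Transducer.moveWork]; omega
      · rw [List.append_nil, update_digitTape_length]; rfl
    | cons b suf ih =>
      intro pre hpre
      simp only [List.length_cons] at hpre
      cases b
      · refine Exec.seq (Exec.loop_done ?_) (Exec.seq (exec_tapeAct hs ?_ ?_)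
          (exec_rewind hs (n := pre.length) (by omega)))
        · rw [Store.view_setTape, digitTape_append_cons]; rfl
        · simp only [Transducer.moveWork]; omega
        · rw [update_digitTape_append_cons]; rfl
      · have h := ih (pre ++ [false]) (by simp; omega)
        rw [List.length_append, List.append_assoc, List.append_assoc] at h
        rcases h with _ | ⟨h1, h2⟩
        refine Exec.seq (Exec.loop_step ?_ (exec_tapeAct hs ?_ ?_) h1) h2
        · rw [Store.view_setTape, digitTape_append_cons]; rfl
        · simp only [Transducer.moveWork]; omega
        · rw [update_digitTape_append_cons]; rfl
  exact Exec.seq (exec_tapeMove hs (by simp [Transducer.moveWork]; omega))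
    (key L [] (by simpa using hL))

theorem exec_scan {L : List Bool} {j : ℕ} (hs : ∀ j, d.workHead j ≤ s) (hj : j + 1 ≤ s)
    (h0 : ∀ q < j, L[q]? = some false) (h1 : L[j]? ≠ some false) :
    Exec x s (scan i) (d.setTape i L 0) (d.setTape i L (j + 1)) := by
  have key : ∀ r q, q + r = j → Exec x s
      (loop (fun w => (w.2 i).isBit false) (tapeAct i id Move.right))
      (d.setTape i L (q + 1)) (d.setTape i L (j + 1)) := by
    intro r
    induction r with
    | zero =>
      rintro q rfl
      refine Exec.loop_done ?_
      rw [Store.view_setTape, digitTape]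
      rcases h : L[q]? with _ | _ | _
      · rfl
      · exact absurd h h1
      · rfl
    | succ r ih =>
      intro q hq
      refine Exec.loop_step ?_ (exec_tapeMove hs (m := Move.right) ?_) (ih (q + 1) (by omega))
      · rw [Store.view_setTape, digitTape, h0 q (by omega)]; rfl
      · simp only [Transducer.moveWork]; omega
  exact Exec.seq (exec_tapeMove hs (by simp [Transducer.moveWork]; omega)) (key j 0 (by omega))

theorem exec_scan_replicate {j : ℕ} (hs : ∀ j, d.workHead j ≤ s) (hj : j + 1 ≤ s) :
    Exec x s (scan i) (d.setTape i (List.replicate j false) 0)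
      (d.setTape i (List.replicate j false) (j + 1)) :=
  exec_scan hs hj (fun q hq => by simp [hq]) (by simp)

theorem exec_scan_append {j : ℕ} {L : List Bool} (hs : ∀ j, d.workHead j ≤ s) (hj : j + 1 ≤ s) :
    Exec x s (scan i) (d.setTape i (List.replicate j false ++ true :: L) 0)
      (d.setTape i (List.replicate j false ++ true :: L) (j + 1)) :=
  exec_scan hs hj (fun q hq => by
    rw [List.getElem?_append_left (by simpa using hq)]; simp [hq]) (by simp)

theorem exec_borrow {j : ℕ} {L : List Bool} (hs : ∀ j, d.workHead j ≤ s) (hj : j + 1 ≤ s) :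
    Exec x s (borrow i) (d.setTape i (List.replicate j false ++ true :: L) (j + 1))
      (d.setTape i (List.replicate j true ++ false :: L) 0) := by
  -- on the way back to cell `0`, the zeros that are still to be passed become ones
  have key : ∀ j (L : List Bool), j + 1 ≤ s → Exec x s
      (loop (fun w => !(w.2 i).isMark) (tapeAct i (fun _ => TapeSym.bit true) Move.left))
      (d.setTape i (List.replicate j false ++ L) j)
      (d.setTape i (List.replicate j true ++ L) 0) := by
    intro j
    induction j with
    | zero => exact fun L _ => Exec.loop_done (by rw [Store.view_setTape]; rfl)
    | succ j ih =>
      intro L hj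
      rw [List.replicate_succ', List.replicate_succ', List.append_assoc, List.append_assoc]
      refine Exec.loop_step ?_ (exec_tapeAct hs (m := Move.left) ?_ ?_)
        (ih ([true] ++ L) (by omega))
      · rw [Store.view_setTape]
        simp [digitTape, TapeSym.isMark]
      · simp only [Transducer.moveWork]; omega
      · have := update_digitTape_append_cons (List.replicate j false) L false true
        rwa [List.length_replicate] at this
  refine Exec.seq (exec_tapeAct hs (m := Move.left) ?_ ?_) (key j (false :: L) hj)
  · simp only [Transducer.moveWork]; omega
  · have := update_digitTape_append_cons (List.replicate j false) L true false
    rwa [List.length_replicate] at this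

end Prog

/-! ### Programs with counters -/

/-- The position of the input head, the values of the counters, and the output. -/
structure Snap (k : ℕ) (β : Type v) where
  pos : ℕ
  ctr : Fin k → ℕ
  out : List β

/-- `L` represents the values `c`, with a number of digits that suffices for values up to `B`.
Leading zeros are allowed, so that `L` is not determined by `c`. -/
def Represents {k : ℕ} (B : ℕ) (c : Fin k → ℕ) (L : Fin k → List Bool) : Prop :=
  ∀ i, digitsValue (L i) = c i ∧ (L i).length ≤ Nat.log 2 B + 1

theorem Represents.update {k B : ℕ} {c : Fin k → ℕ} {L : Fin k → List Bool}
    (h : Represents B c L) (i : Fin k) {n : ℕ} {L' : List Bool} (h1 : digitsValue L' = n)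
    (h2 : L'.length ≤ Nat.log 2 B + 1) :
    Represents B (Function.update c i n) (Function.update L i L') := by
  intro j
  rcases eq_or_ne j i with rfl | hj
  · simpa using ⟨h1, h2⟩
  · simpa [hj] using h j

/-- `Runs x B p σ σ'`: on input `x`, the program `p` leads from `σ` to `σ'`, with counters of values
at most `B` throughout. -/
def Runs {α : Type u} {β : Type v} {k : ℕ} (x : List α) (B : ℕ) (p : Prog α β k)
    (σ σ' : Snap k β) : Prop :=
  ∀ L, Represents B σ.ctr L → ∃ L', Represents B σ'.ctr L' ∧
    Exec x (Nat.log 2 B + 2) p (Store.counters σ.pos L σ.out) (Store.counters σ'.pos L' σ'.out)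

namespace Runs

variable {α : Type u} {β : Type v} {k : ℕ} {x : List α} {B : ℕ} {p q : Prog α β k}
  {σ σ' σ'' : Snap k β}

open Prog

theorem seq (hp : Runs x B p σ σ') (hq : Runs x B q σ' σ'') : Runs x B (p.seq q) σ σ'' := by
  intro L hL
  obtain ⟨L', hL', h1⟩ := hp L hL
  obtain ⟨L'', hL'', h2⟩ := hq L' hL'
  exact ⟨L'', hL'', h1.seq h2⟩

theorem heads_le (pos : ℕ) (L : Fin k → List Bool) (out : List β) (s : ℕ) (j : Fin k) :
    (Store.counters pos L out).workHead j ≤ s := Nat.zero_le _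

theorem inc (i : Fin k) (h : σ.ctr i + 1 ≤ B) :
    Runs x B (Prog.inc i) σ { σ with ctr := Function.update σ.ctr i (σ.ctr i + 1) } := by
  intro L hL
  obtain ⟨h1, h2⟩ := hL i
  have hval : digitsValue (incDigits (L i)) = σ.ctr i + 1 := by
    rw [digitsValue_incDigits, h1]
  refine ⟨Function.update L i (incDigits (L i)), hL.update i hval ?_, ?_⟩
  · have h3 := length_incDigits_le (L i)
    have h4 := Nat.log_mono_right (b := 2) h
    rw [hval] at h3
    omega
  · have := exec_inc (x := x) (i := i) (heads_le σ.pos L σ.out (Nat.log 2 B + 2)) (L := L i)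
      (by omega)
    rwa [Store.setTape_counters, Store.setTape_counters, Function.update_eq_self] at this

/-- The digits of a counter of positive value, before and after a decrement. -/
theorem exists_borrow {c : Fin k → ℕ} {L : Fin k → List Bool} (h : Represents B c L) {i : Fin k}
    {n : ℕ} (hn : c i = n + 1) : ∃ j L', L i = List.replicate j false ++ true :: L' ∧
      j + 1 ≤ Nat.log 2 B + 2 ∧ Represents B (Function.update c i n)
        (Function.update L i (List.replicate j true ++ false :: L')) := by
  obtain ⟨h1, h2⟩ := h i
  rcases eq_replicate_false_or (L i) with ⟨j, hj⟩ | ⟨j, L', hj⟩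
  · rw [hj, digitsValue_replicate_false] at h1; omega
  · rw [hj, digitsValue_borrow] at h1
    rw [hj] at h2
    simp only [List.length_append, List.length_replicate, List.length_cons] at h2
    exact ⟨j, L', hj, by omega, h.update i (by omega) (by simpa using h2)⟩

theorem exists_replicate {c : Fin k → ℕ} {L : Fin k → List Bool} (h : Represents B c L)
    {i : Fin k} (hi : c i = 0) :
    ∃ j, L i = List.replicate j false ∧ j + 1 ≤ Nat.log 2 B + 2 := by
  obtain ⟨h1, h2⟩ := h i
  rcases eq_replicate_false_or (L i) with ⟨j, hj⟩ | ⟨j, L', hj⟩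
  · rw [hj, List.length_replicate] at h2
    exact ⟨j, hj, by omega⟩
  · rw [hj, digitsValue_borrow] at h1; omega

theorem counters_eq_setTape (pos : ℕ) (L : Fin k → List Bool) (out : List β) {i : Fin k}
    {L' : List Bool} (h : L i = L') :
    Store.counters pos L out = (Store.counters pos L out).setTape i L' 0 := by
  rw [Store.setTape_counters, ← h, Function.update_eq_self]

theorem whilePos_zero {i : Fin k} (h : σ.ctr i = 0) : Runs x B (whilePos i p) σ σ := by
  intro L hL
  obtain ⟨j, hj, hlen⟩ := exists_replicate hL h
  refine ⟨L, hL, ?_⟩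
  rw [counters_eq_setTape _ _ _ hj]
  refine Exec.seq (exec_scan_replicate (heads_le _ _ _ _) hlen)
    (Exec.seq (Exec.loop_done ?_) (exec_rewind (heads_le _ _ _ _) hlen))
  rw [Store.view_setTape]
  simp [digitTape, TapeSym.isBit]

theorem whilePos_succ {i : Fin k} {n : ℕ} (h : σ.ctr i = n + 1)
    (hp : Runs x B p { σ with ctr := Function.update σ.ctr i n } σ')
    (hw : Runs x B (whilePos i p) σ' σ'') : Runs x B (whilePos i p) σ σ'' := by
  intro L hL
  obtain ⟨j, M, hj, hlen, hM⟩ := exists_borrow hL h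
  obtain ⟨L', hL', h1⟩ := hp _ hM
  obtain ⟨L'', hL'', h2⟩ := hw L' hL'
  refine ⟨L'', hL'', ?_⟩
  rw [counters_eq_setTape _ _ _ hj]
  -- the remaining iterations start with a scan, which also ends the first iteration
  rcases h2 with _ | ⟨h3, _ | ⟨h4, h5⟩⟩
  refine Exec.seq (exec_scan_append (heads_le _ _ _ _) hlen)
    (Exec.seq (Exec.loop_step ?_ (Exec.seq (exec_borrow (heads_le _ _ _ _) hlen)
      (Exec.seq ?_ h3)) h4) h5)
  · rw [Store.view_setTape]
    simp [digitTape, TapeSym.isBit]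
  · rwa [Store.setTape_counters]

theorem ifPos_zero {i : Fin k} (h : σ.ctr i = 0) (hq : Runs x B q σ σ') :
    Runs x B (ifPos i p q) σ σ' := by
  intro L hL
  obtain ⟨j, hj, hlen⟩ := exists_replicate hL h
  obtain ⟨L', hL', h1⟩ := hq L hL
  refine ⟨L', hL', ?_⟩
  rw [counters_eq_setTape _ _ _ hj] at h1 ⊢
  refine Exec.seq (exec_scan_replicate (heads_le _ _ _ _) hlen) (Exec.branch ?_)
  rw [if_neg]
  · exact Exec.seq (exec_rewind (heads_le _ _ _ _) hlen) h1
  · rw [Store.view_setTape]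
    simp [digitTape, TapeSym.isBit]

theorem ifPos_succ {i : Fin k} {n : ℕ} (h : σ.ctr i = n + 1)
    (hp : Runs x B p { σ with ctr := Function.update σ.ctr i n } σ') :
    Runs x B (ifPos i p q) σ σ' := by
  intro L hL
  obtain ⟨j, M, hj, hlen, hM⟩ := exists_borrow hL h
  obtain ⟨L', hL', h1⟩ := hp _ hM
  refine ⟨L', hL', ?_⟩
  rw [counters_eq_setTape _ _ _ hj]
  refine Exec.seq (exec_scan_append (heads_le _ _ _ _) hlen) (Exec.branch ?_)
  rw [if_pos]
  · refine Exec.seq (exec_borrow (heads_le _ _ _ _) hlen) ?_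
    rwa [Store.setTape_counters]
  · rw [Store.view_setTape]
    simp [digitTape, TapeSym.isBit]

end Runs

/-! ### Passes over the input -/

namespace InCell

def isLetter {α : Type u} : InCell α → Bool
  | leftEnd => false
  | letter _ => true
  | rightEnd => false

end InCell

namespace Prog

variable {α : Type u} {β : Type v} {k : ℕ}

/-- Move the input head and append `w` to the output. -/
def io (m : Move) (w : List β) : Prog α β k :=
  act fun v => (m, fun i => (v.2 i, Move.stay), w)

def emit (w : List β) : Prog α β k := io Move.stay w

def skip : Prog α β k := io Move.stay []

/-- Run the program for the scanned input letter. -/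
def onLetter (f : α → Prog α β k) : Prog α β k :=
  branch fun w =>
    match w.1 with
    | InCell.leftEnd => skip
    | InCell.letter a => f a
    | InCell.rightEnd => skip

/-- From the left end marker, run `p` at all letters of the input from left to right. -/
def forward (p : Prog α β k) : Prog α β k :=
  seq (io Move.right []) (loop (fun w => w.1.isLetter) (seq p (io Move.right [])))

/-- From the right end marker, run `p` at all letters of the input from right to left. -/
def backward (p : Prog α β k) : Prog α β k :=
  seq (io Move.left []) (loop (fun w => w.1.isLetter) (seq p (io Move.left [])))

def rep : ℕ → Prog α β k → Prog α β k
  | 0, _ => skip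
  | n + 1, p => seq (rep n p) p

def seqs : List (Prog α β k) → Prog α β k
  | [] => skip
  | p :: l => seq p (seqs l)

/-- Write the marker into cell `0` of all work tapes. -/
def setup : Prog α β k := act fun _ => (Move.stay, fun _ => (TapeSym.mark, Move.stay), [])

theorem exec_setup (x : List α) (s : ℕ) :
    Exec x s (setup : Prog α β k) initStore (Store.counters 0 (fun _ => []) []) := by
  have key : (initStore : Store k β).apply x (Move.stay, fun _ => (TapeSym.mark, Move.stay), []) =
      Store.counters 0 (fun _ => []) [] := by
    ext1
    · rfl
    · funext i p
      rcases p with _ | p <;> simp [Store.apply, initStore, Store.counters, digitTape]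
    · rfl
    · rfl
  have h := Exec.act (x := x) (s := s) (fun _ : View α k =>
    ((Move.stay, fun _ => (TapeSym.mark, Move.stay), []) : Effect k β)) initStore
  rw [key] at h
  exact h fun _ => Nat.zero_le _

/-- Counters with values linear in the length of the input can be used in logarithmic space. -/
theorem logspaceComputable_of_runs [Finite α] [Finite β] (p : Prog α β k)
    (f : List α → List β) (c : ℕ)
    (h : ∀ x, ∃ σ, Runs x (c * (x.length + 1)) p ⟨0, 0, []⟩ σ ∧ σ.out = f x) :
    LogspaceComputable f := by
  refine logspaceComputable_of_exec (seq setup p) f (c + 3) fun x => ?_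
  obtain ⟨σ, hσ, hout⟩ := h x
  obtain ⟨L, -, hL⟩ := hσ (fun _ => []) fun _ => ⟨rfl, Nat.zero_le _⟩
  -- `c * (n + 1) ≤ 2 ^ c * 2 ^ (log₂ n + 1)`
  have hlog : Nat.log 2 (c * (x.length + 1)) ≤ c + (Nat.log 2 x.length + 1) := by
    have h1 : c * (x.length + 1) ≤ 2 ^ (c + (Nat.log 2 x.length + 1)) := by
      rw [pow_add]
      exact Nat.mul_le_mul Nat.lt_two_pow_self.le
        (Nat.lt_pow_succ_log_self (by norm_num) x.length)
    exact (Nat.log_mono_right h1).trans_eq (Nat.log_pow (by norm_num) _)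
  have hs : Nat.log 2 (c * (x.length + 1)) + 2 ≤ (c + 3) * (Nat.log 2 x.length + 1) := by
    nlinarith
  refine ⟨_, ((exec_setup x _).seq hL).mono hs, hout⟩

end Prog

namespace Runs

variable {α : Type u} {β : Type v} {k : ℕ} {x : List α} {B : ℕ} {p q : Prog α β k}
  {σ σ' σ'' : Snap k β}

open Prog

theorem io (m : Move) (w : List β) : Runs x B (Prog.io m w) σ
    { σ with pos := Store.moveHead x m σ.pos, out := σ.out ++ w } := by
  intro L hL
  refine ⟨L, hL, ?_⟩
  have key : (Store.counters σ.pos L σ.out).apply x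
      (m, fun i => (((Store.counters σ.pos L σ.out).view x).2 i, Move.stay), w) =
      Store.counters (Store.moveHead x m σ.pos) L (σ.out ++ w) := by
    ext1
    · rfl
    · funext i
      simp [Store.apply, Store.view, Store.counters]
    · rfl
    · rfl
  have h := Exec.act (x := x) (s := Nat.log 2 B + 2) (fun v : View α k =>
    ((m, fun i => (v.2 i, Move.stay), w) : Effect k β)) (Store.counters σ.pos L σ.out)
  rw [key] at h
  exact h fun _ => Nat.zero_le _

theorem cast {pos : ℕ} {c c' : Fin k → ℕ} {o o' : List β} (h : Runs x B p σ ⟨pos, c, o⟩)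
    (hc : c = c') (ho : o = o') : Runs x B p σ ⟨pos, c', o'⟩ := by
  rwa [← hc, ← ho]

theorem emit (w : List β) : Runs x B (Prog.emit w) σ { σ with out := σ.out ++ w } :=
  io Move.stay w

theorem skip : Runs x B Prog.skip σ σ := by
  have h := io (x := x) (B := B) (σ := σ) Move.stay []
  rwa [List.append_nil] at h

theorem onLetter {f : α → Prog α β k} {a : α} (ha : Transducer.inCell x σ.pos = InCell.letter a)
    (h : Runs x B (f a) σ σ') : Runs x B (Prog.onLetter f) σ σ' := by
  intro L hL
  obtain ⟨L', hL', h1⟩ := h L hL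
  refine ⟨L', hL', Exec.branch ?_⟩
  have : ((Store.counters σ.pos L σ.out).view x).1 = InCell.letter a := ha
  rwa [this]

theorem loop_done {b : InCell α → Bool} (h : b (Transducer.inCell x σ.pos) = false) :
    Runs x B (Prog.loop (fun w => b w.1) p) σ σ :=
  fun L hL => ⟨L, hL, Exec.loop_done h⟩

theorem loop_step {b : InCell α → Bool} (h : b (Transducer.inCell x σ.pos) = true)
    (hp : Runs x B p σ σ') (hl : Runs x B (Prog.loop (fun w => b w.1) p) σ' σ'') :
    Runs x B (Prog.loop (fun w => b w.1) p) σ σ'' := by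
  intro L hL
  obtain ⟨L', hL', h1⟩ := hp L hL
  obtain ⟨L'', hL'', h2⟩ := hl L' hL'
  exact ⟨L'', hL'', Exec.loop_step h h1 h2⟩

theorem inCell_succ (x : List α) {i : ℕ} (hi : i < x.length) :
    Transducer.inCell x (i + 1) = InCell.letter x[i] := by
  simp [Transducer.inCell, hi]

theorem isLetter_inCell_end (x : List α) :
    (Transducer.inCell x (x.length + 1)).isLetter = false := by
  simp [Transducer.inCell, InCell.isLetter]

/-- In a pass over the input from left to right, `c i` and `o i` are the counters and the output
after `i` letters. -/
theorem forward {c : ℕ → Fin k → ℕ} {o : ℕ → List β}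
    (h : ∀ i < x.length, Runs x B p ⟨i + 1, c i, o i⟩ ⟨i + 1, c (i + 1), o (i + 1)⟩) :
    Runs x B (Prog.forward p) ⟨0, c 0, o 0⟩ ⟨x.length + 1, c x.length, o x.length⟩ := by
  have key : ∀ r i, i + r = x.length →
      Runs x B (Prog.loop (fun w => w.1.isLetter) (p.seq (Prog.io Move.right [])))
        ⟨i + 1, c i, o i⟩ ⟨x.length + 1, c x.length, o x.length⟩ := by
    intro r
    induction r with
    | zero =>
      rintro i rfl
      exact loop_done (isLetter_inCell_end x)
    | succ r ih =>
      intro i hi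
      refine loop_step (b := InCell.isLetter) ?_
        ((h i (by omega)).seq (io Move.right [])) ?_
      · rw [inCell_succ x (by omega)]; rfl
      · have := ih (i + 1) (by omega)
        simpa [Store.moveHead, show i + 1 ≤ x.length by omega] using this
  refine (io Move.right []).seq ?_
  simpa [Store.moveHead] using key x.length 0 (by omega)

/-- In a pass over the input from right to left, `c i` and `o i` are the counters and the output
when `i` letters are left. -/
theorem backward {c : ℕ → Fin k → ℕ} {o : ℕ → List β}
    (h : ∀ i < x.length, Runs x B p ⟨i + 1, c (i + 1), o (i + 1)⟩ ⟨i + 1, c i, o i⟩) :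
    Runs x B (Prog.backward p) ⟨x.length + 1, c x.length, o x.length⟩ ⟨0, c 0, o 0⟩ := by
  have key : ∀ i ≤ x.length,
      Runs x B (Prog.loop (fun w => w.1.isLetter) (p.seq (Prog.io Move.left [])))
        ⟨i, c i, o i⟩ ⟨0, c 0, o 0⟩ := by
    intro i
    induction i with
    | zero => exact fun _ => loop_done rfl
    | succ i ih =>
      intro hi
      refine loop_step (b := InCell.isLetter) ?_ ((h i (by omega)).seq (io Move.left [])) ?_
      · rw [inCell_succ x (by omega)]; rfl
      · simpa [Store.moveHead] using ih (by omega)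
  refine (io Move.left []).seq ?_
  simpa [Store.moveHead] using key x.length le_rfl

theorem rep {n : ℕ} {τ : ℕ → Snap k β} (h : ∀ i < n, Runs x B p (τ i) (τ (i + 1))) :
    Runs x B (Prog.rep n p) (τ 0) (τ n) := by
  induction n with
  | zero => exact skip
  | succ n ih => exact (ih fun i hi => h i (by omega)).seq (h n (by omega))

theorem seqs {ι : Type*} {pos : ℕ} {c : Fin k → ℕ} {f : ι → Prog α β k} {g : ι → List β}
    (l : List ι) (h : ∀ a o, Runs x B (f a) ⟨pos, c, o⟩ ⟨pos, c, o ++ g a⟩) (o : List β) :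
    Runs x B (Prog.seqs (l.map f)) ⟨pos, c, o⟩ ⟨pos, c, o ++ l.flatMap g⟩ := by
  induction l generalizing o with
  | nil => exact skip.cast rfl (List.append_nil o).symm
  | cons a l ih =>
    exact ((h a o).seq (ih (o ++ g a))).cast rfl (by rw [List.flatMap_cons, List.append_assoc])

end Runs

/-! ### The reduction as a program -/

namespace Reduction

/-- The data from which the reduction is built. The input alphabet is `α`. The letter `a` stands
for `h t ^ d a` with `h` given by the word `word a` over the alphabet `A`, `D` is a bound for
`|d a|`, and `image b` is a word for the image of `b : A` under the endomorphism. -/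
structure Data (α : Type u) (A : Type v) where
  card : ℕ
  index : A ≃ Fin card
  d : α → ℤ
  D : ℕ
  abs_d_le : ∀ a, |d a| ≤ D
  word : α → List A
  image : A → List A

variable {α : Type u} {A : Type v} (R : Data α A)

namespace Data

/-- The exponent sum of `t` in the prefix of length `i`. -/
def height (x : List α) (i : ℕ) : ℤ := ((x.take i).map R.d).sum

/-- The exponent of the endomorphism that is applied to the letter at position `i`. It is shifted
by `D` times the length of the input, so that it is a natural number. -/
def level (x : List α) (i : ℕ) : ℕ := (R.D * x.length - R.height x i).toNat

/-- The number of the variable for the image of `b` under the `k`-th power of the endomorphism. -/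
def varNum (k : ℕ) (b : A) : ℕ := 1 + k * R.card + R.index b

/-- The letters of `A` in the order of their indices. -/
def letters : List A := (List.finRange R.card).map R.index.symm

/-- The name of a variable. -/
def nameString (k : ℕ) (b : A) : List (SLPSymbol A) :=
  SLPSymbol.var :: List.replicate (R.varNum k b) SLPSymbol.one

/-- The names contributed by the position `i` of the input to the right-hand side of the start
variable. -/
def positionString (x : List α) (i : ℕ) : List (SLPSymbol A) :=
  (x[i]?.elim [] R.word).flatMap (R.nameString (R.level x i))

/-- The rules for the power `k + 1` of the endomorphism. -/
def levelString (k : ℕ) : List (SLPSymbol A) :=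
  R.letters.flatMap fun b => (R.image b).flatMap (R.nameString k) ++ [SLPSymbol.sep]

/-- The string for the straight-line program. -/
def slpString (x : List α) : List (SLPSymbol A) :=
  [SLPSymbol.var, SLPSymbol.sep] ++ (List.range x.length).flatMap (R.positionString x) ++
    [SLPSymbol.sep] ++ (R.letters.flatMap fun b => [SLPSymbol.letter b, SLPSymbol.sep]) ++
    (List.range (2 * R.D * x.length)).flatMap R.levelString

/-- The function computed by the reduction; the empty string encodes no program. -/
def output (x : List α) : List (SLPSymbol A) :=
  if R.height x x.length = 0 then R.slpString x else []

theorem height_succ (x : List α) {i : ℕ} (hi : i < x.length) :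
    R.height x (i + 1) = R.height x i + R.d x[i] := by
  rw [height, height, List.take_succ_eq_append_getElem hi, List.map_append, List.sum_append,
    List.map_singleton, List.sum_singleton]

theorem abs_height_le (x : List α) {i : ℕ} (hi : i ≤ x.length) :
    |R.height x i| ≤ R.D * i := by
  induction i with
  | zero => simp [height]
  | succ i ih =>
    rw [R.height_succ x (by omega)]
    have h1 := ih (by omega)
    have h2 := R.abs_d_le x[i]
    have h3 := abs_add_le (R.height x i) (R.d x[i])
    push_cast
    linarith

/-- The bound that makes all levels natural numbers up to `2 * D * x.length`. -/
theorem abs_height_le' (x : List α) {i : ℕ} (hi : i ≤ x.length) :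
    |R.height x i| ≤ R.D * x.length :=
  (R.abs_height_le x hi).trans (by gcongr)

theorem level_cast (x : List α) {i : ℕ} (hi : i ≤ x.length) :
    (R.level x i : ℤ) = R.D * x.length - R.height x i :=
  Int.toNat_of_nonneg (by have := abs_le.1 (R.abs_height_le' x hi); linarith)

theorem level_le (x : List α) {i : ℕ} (hi : i ≤ x.length) :
    R.level x i ≤ 2 * R.D * x.length := by
  have h1 := R.level_cast x hi
  have h2 := abs_le.1 (R.abs_height_le' x hi)
  zify
  linarith

end Data

open Prog

/-- Append the name of the variable for `b` and the power given by counter `0`. Counter `1` serves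
to restore counter `0`. -/
def emitName (b : A) : Prog α (SLPSymbol A) 2 :=
  seq (emit [SLPSymbol.var, SLPSymbol.one]) <|
  seq (whilePos 0 (seq (inc 1) (emit (List.replicate R.card SLPSymbol.one)))) <|
  seq (whilePos 1 (inc 0)) (emit (List.replicate (R.index b) SLPSymbol.one))

/-- Add `n` to counter `0`. -/
def addCtr (n : ℕ) : Prog α (SLPSymbol A) 2 := rep n (inc 0)

/-- Subtract `n` from counter `0`, truncated at `0`. -/
def subCtr (n : ℕ) : Prog α (SLPSymbol A) 2 := rep n (ifPos 0 skip skip)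

/-- Write the string for the straight-line program, starting with the input head at the left end
marker and counters of value `0`. -/
def emitSLP : Prog α (SLPSymbol A) 2 :=
  seq (emit [SLPSymbol.var, SLPSymbol.sep]) <|
  seq (forward (addCtr R.D)) <|
  seq (backward skip) <|
  seq (forward (onLetter fun a => seq (seqs ((R.word a).map (emitName R)))
    (seq (addCtr (-R.d a).toNat) (subCtr (R.d a).toNat)))) <|
  seq (emit [SLPSymbol.sep]) <|
  seq (backward (subCtr R.D)) <|
  seq (emit (R.letters.flatMap fun b => [SLPSymbol.letter b, SLPSymbol.sep])) <|
  forward (rep (2 * R.D) (seq (seqs (R.letters.map fun b =>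
    seq (seqs ((R.image b).map (emitName R))) (emit [SLPSymbol.sep]))) (inc 0)))

/-- The program for the reduction. Counter `0` is first set to `k + 1`, where `k` is the level at
the end of the input, and then decreased by `D` times the length of the input in truncated
subtraction. The result is `1` if and only if the exponent sum is `0`. -/
def program : Prog α (SLPSymbol A) 2 :=
  seq (forward (onLetter fun a => addCtr (R.D - R.d a).toNat)) <|
  seq (inc 0) <|
  seq (backward (subCtr R.D)) <|
  ifPos 0 (ifPos 0 skip (emitSLP R)) skip

variable {x : List α} {B pos : ℕ} {o : List (SLPSymbol A)}

theorem update_zero (c c' e : ℕ) : Function.update ![c, c'] 0 e = ![e, c'] := by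
  funext i; fin_cases i <;> rfl

theorem update_one (c c' e : ℕ) : Function.update ![c, c'] 1 e = ![c, e] := by
  funext i; fin_cases i <;> rfl

theorem runs_inc {c : ℕ} (h : c + 1 ≤ B) :
    Runs x B (inc 0 : Prog α (SLPSymbol A) 2) ⟨pos, ![c, 0], o⟩ ⟨pos, ![c + 1, 0], o⟩ := by
  have := Runs.inc (x := x) (B := B) (σ := ⟨pos, ![c, 0], o⟩) 0 h
  rwa [update_zero] at this

theorem runs_addCtr {c n : ℕ} (h : c + n ≤ B) :
    Runs x B (addCtr n : Prog α (SLPSymbol A) 2) ⟨pos, ![c, 0], o⟩ ⟨pos, ![c + n, 0], o⟩ := by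
  exact Runs.rep (τ := fun i => ⟨pos, ![c + i, 0], o⟩) fun i hi => runs_inc (by omega)

theorem runs_subCtr {c n : ℕ} :
    Runs x B (subCtr n : Prog α (SLPSymbol A) 2) ⟨pos, ![c, 0], o⟩ ⟨pos, ![c - n, 0], o⟩ := by
  refine Runs.rep (τ := fun i => ⟨pos, ![c - i, 0], o⟩) fun i hi => ?_
  rcases h : c - i with _ | e
  · rw [show c - (i + 1) = 0 by omega]
    exact Runs.ifPos_zero rfl Runs.skip
  · rw [show c - (i + 1) = e by omega]
    refine Runs.ifPos_succ (n := e) rfl ?_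
    simpa [update_zero] using Runs.skip

/-- The first loop of `emitName` moves counter `0` to counter `1`. -/
theorem runs_transfer {c : ℕ} : ∀ {c' : ℕ} {o : List (SLPSymbol A)}, c + c' ≤ B →
    Runs x B (whilePos 0 (seq (inc 1) (emit (List.replicate R.card SLPSymbol.one))))
      ⟨pos, ![c, c'], o⟩
      ⟨pos, ![0, c + c'], o ++ List.replicate (c * R.card) SLPSymbol.one⟩ := by
  induction c with
  | zero =>
    intro c' o h
    simpa using Runs.whilePos_zero rfl
  | succ c ih =>
    intro c' o h
    have h1 := Runs.inc (x := x) (B := B) (σ := ⟨pos, ![c, c'], o⟩) 1 (by simp; omega)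
    simp only [Matrix.cons_val_one, Matrix.cons_val_fin_one, update_one] at h1
    refine Runs.whilePos_succ (n := c) rfl ?_ ((ih (c' := c' + 1)
      (o := o ++ List.replicate R.card SLPSymbol.one) (by omega)).cast
      (congrArg (![0, ·]) (by omega)) ?_)
    · simp only [update_zero]
      exact h1.seq (Runs.emit _)
    · rw [List.append_assoc, List.replicate_append_replicate]
      congr 2; ring

/-- The second loop of `emitName` moves counter `1` back to counter `0`. -/
theorem runs_restore {c' : ℕ} : ∀ {c : ℕ}, c + c' ≤ B →
    Runs x B (whilePos 1 (inc 0) : Prog α (SLPSymbol A) 2) ⟨pos, ![c, c'], o⟩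
      ⟨pos, ![c + c', 0], o⟩ := by
  induction c' with
  | zero => intro c h; exact Runs.whilePos_zero rfl
  | succ c' ih =>
    intro c h
    refine Runs.whilePos_succ (n := c') rfl (Runs.inc 0 ?_) ?_
    · simp; omega
    · have := ih (c := c + 1) (by omega)
      simpa [update_zero, update_one, Nat.add_assoc, Nat.add_comm 1 c'] using this

theorem runs_emitName {c : ℕ} (h : c ≤ B) (b : A) :
    Runs x B (emitName R b) ⟨pos, ![c, 0], o⟩ ⟨pos, ![c, 0], o ++ R.nameString c b⟩ := by
  refine (Runs.emit _).seq ((runs_transfer R (by simpa using h)).seq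
    ((runs_restore (by simpa using h)).seq ((Runs.emit _).cast (by simp) ?_)))
  simp only [Data.nameString, Data.varNum, List.append_assoc, List.replicate_append_replicate,
    List.cons_append, List.nil_append]
  rw [Nat.add_assoc, Nat.add_comm 1, List.replicate_succ]

theorem runs_emitSLP (h0 : R.height x x.length = 0) (hB : 2 * R.D * x.length ≤ B) :
    Runs x B (emitSLP R) ⟨0, ![0, 0], []⟩
      ⟨x.length + 1, ![2 * R.D * x.length, 0], R.slpString x⟩ := by
  have hlev0 : R.level x 0 = R.D * x.length := by
    zify; simp [R.level_cast x (Nat.zero_le _), Data.height]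
  have hlevn : R.level x x.length = R.D * x.length := by
    zify; simp [R.level_cast x le_rfl, h0]
  have hmul : ∀ i < x.length, 2 * R.D * i + 2 * R.D ≤ B := fun i hi =>
    le_trans (by rw [← Nat.mul_succ]; exact Nat.mul_le_mul_left _ hi) hB
  refine (Runs.emit [SLPSymbol.var, SLPSymbol.sep]).seq ?_
  refine ((Runs.forward (c := fun i => ![R.D * i, 0])
    (o := fun _ => [SLPSymbol.var, SLPSymbol.sep]) fun i hi => ?_)).seq ?_
  · refine (runs_addCtr ?_).cast rfl rfl
    have := hmul i hi
    nlinarith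
  refine (Runs.backward (c := fun _ => ![R.D * x.length, 0])
    (o := fun _ => [SLPSymbol.var, SLPSymbol.sep]) fun i hi => Runs.skip).seq ?_
  have hnames := Runs.forward (x := x) (B := B) (c := fun i => ![R.level x i, 0])
    (o := fun i => [SLPSymbol.var, SLPSymbol.sep] ++ (List.range i).flatMap (R.positionString x))
    (p := onLetter fun a => seq (seqs ((R.word a).map (emitName R)))
      (seq (addCtr (-R.d a).toNat) (subCtr (R.d a).toNat))) (fun i hi => by
      refine Runs.onLetter (Runs.inCell_succ x hi) ?_
      have e1 := R.level_cast x hi.le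
      have e2 := R.level_cast x (i := i + 1) hi
      rw [R.height_succ x hi] at e2
      have e3 := (R.level_le x hi.le).trans hB
      have e4 := (R.level_le x (i := i + 1) hi).trans hB
      refine (Runs.seqs (R.word x[i]) (fun b o => runs_emitName R e3 b) _).seq
        ((runs_addCtr (n := (-R.d x[i]).toNat) (by omega)).seq
          ((runs_subCtr (n := (R.d x[i]).toNat)).cast (congrArg (![·, 0]) (by omega)) ?_))
      simp [List.range_succ, Data.positionString, hi])
  simp only [hlev0, hlevn, List.range_zero, List.flatMap_nil, List.append_nil] at hnames
  refine hnames.seq ((Runs.emit [SLPSymbol.sep]).seq ?_)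
  refine (Runs.backward (c := fun i => ![R.D * i, 0]) (o := fun _ => _) fun i hi => ?_).seq ?_
  · exact runs_subCtr.cast (congrArg (![·, 0]) (by rw [Nat.mul_succ]; omega)) rfl
  refine (Runs.emit _).seq ?_
  have hrules := Runs.forward (x := x) (B := B) (c := fun i => ![2 * R.D * i, 0])
    (o := fun i => [SLPSymbol.var, SLPSymbol.sep] ++
      (List.range x.length).flatMap (R.positionString x) ++ [SLPSymbol.sep] ++
      (R.letters.flatMap fun b => [SLPSymbol.letter b, SLPSymbol.sep]) ++
      (List.range (2 * R.D * i)).flatMap R.levelString)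
    (p := rep (2 * R.D) (seq (seqs (R.letters.map fun b =>
      seq (seqs ((R.image b).map (emitName R))) (emit [SLPSymbol.sep]))) (inc 0)))
    (fun i hi => Runs.rep (τ := fun q => ⟨i + 1, ![2 * R.D * i + q, 0], _ ++
      (List.range (2 * R.D * i + q)).flatMap R.levelString⟩) fun q hq => by
      have h1 := hmul i hi
      refine (Runs.seqs R.letters (fun b o =>
        ((Runs.seqs (R.image b) (fun b o => runs_emitName R (by omega) b) o).seq
          (Runs.emit [SLPSymbol.sep])).cast rfl (List.append_assoc _ _ _)) _).seq
            ((runs_inc (by omega)).cast rfl ?_)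
      rw [← Nat.add_assoc, List.range_succ, List.flatMap_append]
      simp [Data.levelString])
  simp only [Nat.mul_zero, List.range_zero, List.flatMap_nil, List.append_nil] at hrules
  exact hrules

theorem runs_program (hB : 2 * R.D * x.length + 1 ≤ B) :
    ∃ σ, Runs x B (program R) ⟨0, 0, []⟩ σ ∧ σ.out = R.output x := by
  have h1 : Runs x B (forward (onLetter fun a => addCtr (R.D - R.d a).toNat))
      ⟨0, ![0, 0], ([] : List (SLPSymbol A))⟩
      ⟨x.length + 1, ![(R.D * x.length - R.height x x.length : ℤ).toNat, 0], []⟩ := by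
    have := Runs.forward (x := x) (B := B)
      (c := fun i => ![(R.D * i - R.height x i : ℤ).toNat, 0])
      (o := fun _ => ([] : List (SLPSymbol A)))
      (p := onLetter fun a => addCtr (R.D - R.d a).toNat) (fun i hi => by
        refine Runs.onLetter (Runs.inCell_succ x hi) ?_
        have e1 := abs_le.1 (R.abs_height_le x hi.le)
        have e2 := abs_le.1 (R.abs_d_le x[i])
        have e3 := abs_le.1 (R.abs_height_le x (i := i + 1) hi)
        have e4 := R.height_succ x hi
        have e5 := Nat.mul_le_mul_left (2 * R.D) (show i + 1 ≤ x.length from hi)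
        zify at hB e5
        push_cast at e3
        refine (runs_addCtr ?_).cast (congrArg (![·, 0]) ?_) rfl
        · zify
          rw [Int.toNat_of_nonneg (by linarith), Int.toNat_of_nonneg (by linarith)]
          linarith
        · zify
          rw [Int.toNat_of_nonneg (by linarith), Int.toNat_of_nonneg (by linarith),
            Int.toNat_of_nonneg (by linarith)]
          linarith)
    simpa [Data.height] using this
  have e1 := abs_le.1 (R.abs_height_le x le_rfl)
  have h2 : (R.D * x.length - R.height x x.length : ℤ).toNat + 1 ≤ B := by
    zify at hB ⊢
    rw [Int.toNat_of_nonneg (by linarith)]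
    linarith
  set e := (R.D * x.length - R.height x x.length : ℤ).toNat + 1 with he
  have h3 : Runs x B (backward (subCtr R.D)) ⟨x.length + 1, ![e, 0], ([] : List (SLPSymbol A))⟩
      ⟨0, ![e - R.D * x.length, 0], []⟩ := by
    have := Runs.backward (x := x) (B := B) (c := fun i => ![e - R.D * (x.length - i), 0])
      (o := fun _ => ([] : List (SLPSymbol A))) (p := subCtr R.D) (fun i hi => by
        refine runs_subCtr.cast (congrArg (![·, 0]) ?_) rfl
        rw [show x.length - i = x.length - (i + 1) + 1 by omega, Nat.mul_succ]
        omega)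
    simpa using this
  have hstart : (⟨0, 0, []⟩ : Snap 2 (SLPSymbol A)) = ⟨0, ![0, 0], []⟩ := by
    congr 1; funext i; fin_cases i <;> rfl
  rw [hstart]
  have key : ∀ σ, Runs x B (ifPos 0 (ifPos 0 skip (emitSLP R)) skip)
      ⟨0, ![e - R.D * x.length, 0], []⟩ σ → Runs x B (program R) ⟨0, ![0, 0], []⟩ σ :=
    fun σ h => h1.seq ((runs_inc h2).seq (h3.seq h))
  -- the difference is `0`, `1`, or larger if the exponent sum is positive, zero, or negative
  rcases hc : e - R.D * x.length with _ | _ | c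
  · refine ⟨_, key _ (Runs.ifPos_zero hc Runs.skip), ?_⟩
    rw [Data.output, if_neg]
    intro h0
    rw [h0, sub_zero] at he
    omega
  · refine ⟨⟨x.length + 1, ![2 * R.D * x.length, 0], R.slpString x⟩,
      key _ (Runs.ifPos_succ (n := 0) hc ?_), ?_⟩
    · simp only [update_zero]
      refine Runs.ifPos_zero rfl (runs_emitSLP R ?_ (by omega))
      omega
    · rw [Data.output, if_pos]
      omega
  · refine ⟨_, key _ (Runs.ifPos_succ (n := c + 1) hc (Runs.ifPos_succ (n := c) ?_ Runs.skip)), ?_⟩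
    · simp
    · rw [Data.output, if_neg]
      intro h0
      rw [h0, sub_zero] at he
      omega

theorem logspaceComputable_output [Finite α] [Finite A] : LogspaceComputable R.output :=
  logspaceComputable_of_runs (program R) R.output (2 * R.D + 1) fun x =>
    runs_program R (by nlinarith)

end Reduction

/-! ### Strings determine straight-line programs -/

namespace SLPSymbol

def isSep {A : Type u} : SLPSymbol A → Bool
  | letter _ => false
  | var => false
  | one => false
  | sep => true

end SLPSymbol

namespace SLP

variable {A : Type u} {n : ℕ}

theorem encodeRhs_cons (s : Fin n ⊕ A) (r : List (Fin n ⊕ A)) :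
    encodeRhs (s :: r) = Sum.elim encodeVar (fun a => [SLPSymbol.letter a]) s ++ encodeRhs r := by
  simp [encodeRhs]

theorem head?_encodeRhs_append_ne (r : List (Fin n ⊕ A)) (l : List (SLPSymbol A)) :
    (encodeRhs r ++ l).head? ≠ some SLPSymbol.one := by
  rcases r with _ | ⟨i | a, r⟩ <;> simp [encodeRhs, encodeVar]

theorem replicate_append_inj {β : Type*} {b : β} : ∀ {i j : ℕ} {l l' : List β},
    l.head? ≠ some b → l'.head? ≠ some b →
    List.replicate i b ++ l = List.replicate j b ++ l' → i = j ∧ l = l'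
  | 0, 0, _, _, _, _, h => ⟨rfl, by simpa using h⟩
  | 0, j + 1, _, _, hl, _, h => by
    rw [List.replicate_zero, List.nil_append] at h
    simp [h, List.replicate_succ] at hl
  | i + 1, 0, _, _, _, hl', h => by
    rw [List.replicate_zero, List.nil_append] at h
    simp [← h, List.replicate_succ] at hl'
  | i + 1, j + 1, l, l', hl, hl', h => by
    simp only [List.replicate_succ, List.cons_append, List.cons.injEq, true_and] at h
    obtain ⟨rfl, h'⟩ := replicate_append_inj hl hl' h
    exact ⟨rfl, h'⟩

/-- The encodings of right-hand sides form a prefix code. -/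
theorem encodeRhs_append_inj : ∀ {r r' : List (Fin n ⊕ A)} {l l' : List (SLPSymbol A)},
    encodeRhs r ++ l = encodeRhs r' ++ l' → r = r' ∧ l = l'
  | [], [], _, _, h => by simpa [encodeRhs] using h
  | [], Sum.inl _ :: _, _, _, h => by simp [encodeRhs, encodeVar] at h
  | [], Sum.inr _ :: _, _, _, h => by simp [encodeRhs] at h
  | Sum.inl _ :: _, [], _, _, h => by simp [encodeRhs, encodeVar] at h
  | Sum.inr _ :: _, [], _, _, h => by simp [encodeRhs] at h
  | Sum.inl _ :: _, Sum.inr _ :: _, _, _, h => by simp [encodeRhs, encodeVar] at h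
  | Sum.inr _ :: _, Sum.inl _ :: _, _, _, h => by simp [encodeRhs, encodeVar] at h
  | Sum.inr a :: r, Sum.inr a' :: r', l, l', h => by
    simp only [encodeRhs_cons, Sum.elim_inr, List.cons_append, List.nil_append, List.cons.injEq,
      SLPSymbol.letter.injEq] at h
    obtain ⟨rfl, rfl⟩ := encodeRhs_append_inj h.2
    exact ⟨by rw [h.1], rfl⟩
  | Sum.inl i :: r, Sum.inl i' :: r', l, l', h => by
    simp only [encodeRhs_cons, Sum.elim_inl, encodeVar, List.cons_append, List.append_assoc,
      List.cons.injEq, true_and] at h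
    obtain ⟨hi, h⟩ := replicate_append_inj (head?_encodeRhs_append_ne _ _)
      (head?_encodeRhs_append_ne _ _) h
    obtain ⟨rfl, rfl⟩ := encodeRhs_append_inj h
    exact ⟨by rw [Fin.ext hi], rfl⟩

theorem flatMap_encodeRhs_inj {V : Type*} {f g : V → List (Fin n ⊕ A)} : ∀ {l : List V},
    l.flatMap (fun X => encodeRhs (f X)) = l.flatMap (fun X => encodeRhs (g X)) →
    ∀ X ∈ l, f X = g X
  | [], _, _, hX => by simp at hX
  | Y :: l, h, X, hX => by
    rw [List.flatMap_cons, List.flatMap_cons] at h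
    obtain ⟨h1, h2⟩ := encodeRhs_append_inj h
    rcases List.mem_cons.1 hX with rfl | hX
    · exact h1
    · exact flatMap_encodeRhs_inj h2 X hX

theorem encode_eq (P : SLP (Fin n) A) :
    P.encode = encodeRhs [Sum.inl P.start] ++
      (List.finRange n).flatMap fun X => encodeRhs (P.rho X) := by
  simp [encode, encodeRhs]

theorem countP_encodeRhs (r : List (Fin n ⊕ A)) :
    (encodeRhs r).countP SLPSymbol.isSep = 1 := by
  induction r with
  | nil => rfl
  | cons s r ih =>
    rw [encodeRhs_cons, List.countP_append, ih]
    rcases s with i | a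
    · simp [encodeVar, SLPSymbol.isSep, List.countP_replicate]
    · simp [SLPSymbol.isSep]

/-- The number of variables can be read off from the string. -/
theorem countP_encode (P : SLP (Fin n) A) : P.encode.countP SLPSymbol.isSep = 1 + n := by
  simp [encode_eq, List.countP_append, List.countP_flatMap, Function.comp_def, countP_encodeRhs]

theorem encode_ne_nil (P : SLP (Fin n) A) : P.encode ≠ [] := by
  simp [encode, encodeVar]

theorem encode_injective : Function.Injective (encode : SLP (Fin n) A → List (SLPSymbol A)) := by
  intro P P' h
  rw [encode_eq, encode_eq] at h
  obtain ⟨h1, h2⟩ := encodeRhs_append_inj h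
  have h3 : P.rho = P'.rho := funext fun X => flatMap_encodeRhs_inj h2 X (List.mem_finRange X)
  have h4 : P.start = P'.start := by simpa using h1
  cases P
  cases P'
  cases h3
  cases h4
  rfl

theorem acyclic_of_rank {V : Type v} {rho : V → List (V ⊕ A)} (rank : V → ℕ)
    (h : ∀ X Y, Sum.inl Y ∈ rho X → rank Y < rank X) (X : V) :
    ¬ Relation.TransGen (fun X Y => Sum.inl Y ∈ rho X) X X := by
  have key : ∀ Y, Relation.TransGen (fun X Y => Sum.inl Y ∈ rho X) X Y → rank Y < rank X := by
    intro Y hY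
    induction hY with
    | single hY => exact h _ _ hY
    | tail _ hY ih => exact (h _ _ hY).trans ih
  exact fun hX => lt_irrefl _ (key X hX)

end SLP

theorem encode_mem_compressedWordProblem {G : Type u} [Group G] {S : Finset G} {n : ℕ}
    (P : SLP (Fin n) S) : P.encode ∈ compressedWordProblem S ↔ wordValue S P.val = 1 := by
  refine ⟨?_, fun h => ⟨n, P, rfl, h⟩⟩
  rintro ⟨n', P', h, h1⟩
  have hn : n' = n := by
    have := congrArg (List.countP SLPSymbol.isSep) h
    rw [SLP.countP_encode, SLP.countP_encode] at this
    omega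
  subst hn
  rwa [SLP.encode_injective h]

theorem nil_notMem_compressedWordProblem {G : Type u} [Group G] {S : Finset G} :
    [] ∉ compressedWordProblem S := by
  rintro ⟨n, P, h, -⟩
  exact P.encode_ne_nil h.symm

/-! ### The straight-line program of the reduction -/

theorem List.flatMap_finRange_mul {β : Type*} (m n : ℕ) (f : Fin (m * n) → List β) :
    (List.finRange (m * n)).flatMap f = (List.finRange m).flatMap fun k =>
      (List.finRange n).flatMap fun j => f (finProdFinEquiv (k, j)) := by
  have h : ∀ (N : ℕ) (g : Fin N → List β),
      (List.finRange N).flatMap g = (List.ofFn g).flatten := by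
    intro N g
    rw [List.ofFn_eq_map, List.flatMap_def]
  simp only [h]
  rw [List.ofFn_mul, List.flatten_flatten, List.map_ofFn]
  congr 2
  funext k
  simp only [Function.comp]
  congr 2
  funext j
  congr 1
  apply Fin.ext
  simp [finProdFinEquiv, mul_comm, add_comm]

namespace Reduction.Data

variable {α : Type u} {A : Type v} (R : Data α A)

/-- The variable for the image of `b` under the `k`-th power of the endomorphism. -/
def powVar {K : ℕ} (k : Fin (K + 1)) (b : A) : Fin ((K + 1) * R.card + 1) :=
  Fin.succ (finProdFinEquiv (k, R.index b))

theorem encodeVar_powVar {K : ℕ} (k : Fin (K + 1)) (b : A) :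
    (SLP.encodeVar (R.powVar k b) : List (SLPSymbol A)) = R.nameString k b := by
  rw [SLP.encodeVar, nameString, varNum, powVar, Fin.val_succ, finProdFinEquiv_apply_val]
  congr 2
  ring

/-- The right-hand side of the variable for the image of `b` under the `k`-th power. -/
def levelRhs (K : ℕ) (k : Fin (K + 1)) (b : A) : List (Fin ((K + 1) * R.card + 1) ⊕ A) :=
  Fin.cases [Sum.inr b] (fun k => (R.image b).map fun c => Sum.inl (R.powVar k.castSucc c)) k

/-- The right-hand side of the start variable. In `slp`, `K` is a bound for all levels, so
that `Fin.ofNat` does not reduce them. -/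
def startRhs (x : List α) (K : ℕ) : List (Fin ((K + 1) * R.card + 1) ⊕ A) :=
  (List.range x.length).flatMap fun i => (x[i]?.elim [] R.word).map fun b =>
    Sum.inl (R.powVar (Fin.ofNat (K + 1) (R.level x i)) b)

/-- The right-hand sides; variable `0` is the start variable. -/
def rhs (x : List α) (K : ℕ) (X : Fin ((K + 1) * R.card + 1)) :
    List (Fin ((K + 1) * R.card + 1) ⊕ A) :=
  Fin.cases (R.startRhs x K) (fun z => R.levelRhs K (finProdFinEquiv.symm z).1
    (R.index.symm (finProdFinEquiv.symm z).2)) X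

theorem rhs_powVar (x : List α) {K : ℕ} (k : Fin (K + 1)) (b : A) :
    R.rhs x K (R.powVar k b) = R.levelRhs K k b := by
  rw [rhs, powVar, Fin.cases_succ, Equiv.symm_apply_apply, Equiv.symm_apply_apply]

/-- Along the rules, the power of the endomorphism decreases. -/
def rank (K : ℕ) (X : Fin ((K + 1) * R.card + 1)) : ℕ :=
  Fin.cases (K + 1) (fun z => (finProdFinEquiv.symm z).1) X

theorem rank_powVar {K : ℕ} (k : Fin (K + 1)) (b : A) : R.rank K (R.powVar k b) = k := by
  rw [rank, powVar, Fin.cases_succ, Equiv.symm_apply_apply]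

theorem rank_lt (x : List α) (K : ℕ) (X Y : Fin ((K + 1) * R.card + 1))
    (h : Sum.inl Y ∈ R.rhs x K X) : R.rank K Y < R.rank K X := by
  induction X using Fin.cases with
  | zero =>
    simp only [rhs, Fin.cases_zero, startRhs, List.mem_flatMap, List.mem_map] at h
    obtain ⟨i, -, b, -, h⟩ := h
    obtain rfl := Sum.inl.inj h
    rw [rank_powVar]
    exact Fin.is_lt _
  | succ z =>
    obtain ⟨⟨k, j⟩, rfl⟩ := finProdFinEquiv.surjective z
    simp only [rhs, rank, Fin.cases_succ, Equiv.symm_apply_apply] at h ⊢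
    induction k using Fin.cases with
    | zero => simp [levelRhs] at h
    | succ k =>
      simp only [levelRhs, Fin.cases_succ, List.mem_map] at h
      obtain ⟨b, -, h⟩ := h
      obtain rfl := Sum.inl.inj h
      have := R.rank_powVar k.castSucc b
      rw [rank] at this
      rw [this]
      simp

/-- The straight-line program for the product of the images of the letters of the input. -/
def slp (x : List α) : SLP (Fin ((2 * R.D * x.length + 1) * R.card + 1)) A where
  start := 0
  rho := R.rhs x _
  acyclic := SLP.acyclic_of_rank (R.rank _) (R.rank_lt x _)

theorem level_ofNat (x : List α) {i : ℕ} (hi : i ≤ x.length) :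
    (Fin.ofNat (2 * R.D * x.length + 1) (R.level x i) : ℕ) = R.level x i := by
  rw [Fin.val_ofNat, Nat.mod_eq_of_lt (Nat.lt_succ_of_le (R.level_le x hi))]

theorem encodeRhs_map_inl {n : ℕ} {ι : Type*} (l : List ι) (f : ι → Fin n) :
    (SLP.encodeRhs (l.map fun b => Sum.inl (f b)) : List (SLPSymbol A)) =
      l.flatMap (fun b => SLP.encodeVar (f b)) ++ [SLPSymbol.sep] := by
  simp [SLP.encodeRhs, List.flatMap_map]

theorem encode_slp (x : List α) : (R.slp x).encode = R.slpString x := by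
  have hstart : (SLP.encodeRhs (R.startRhs x (2 * R.D * x.length)) : List (SLPSymbol A)) =
      (List.range x.length).flatMap (R.positionString x) ++ [SLPSymbol.sep] := by
    rw [SLP.encodeRhs, startRhs, List.flatMap_assoc]
    congr 1
    refine List.flatMap_congr fun i hi => ?_
    rw [List.flatMap_map, positionString]
    refine List.flatMap_congr fun b _ => ?_
    rw [Sum.elim_inl, encodeVar_powVar, R.level_ofNat x (List.mem_range.1 hi).le]
  have hlevel : ∀ k : Fin (2 * R.D * x.length),
      ((List.finRange R.card).flatMap fun j =>
        SLP.encodeRhs (R.levelRhs (2 * R.D * x.length) k.succ (R.index.symm j))) =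
      R.levelString k := by
    intro k
    rw [levelString, letters, List.flatMap_map]
    refine List.flatMap_congr fun j _ => ?_
    simp only [levelRhs, Fin.cases_succ, encodeRhs_map_inl, encodeVar_powVar]
    rfl
  have hrules : ((List.finRange ((2 * R.D * x.length + 1) * R.card)).flatMap fun z =>
      SLP.encodeRhs (R.rhs x _ z.succ)) =
      (R.letters.flatMap fun b => [SLPSymbol.letter b, SLPSymbol.sep]) ++
        (List.range (2 * R.D * x.length)).flatMap R.levelString := by
    rw [List.flatMap_finRange_mul, List.finRange_succ, List.flatMap_cons, List.flatMap_map]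
    simp only [rhs, Fin.cases_succ, Equiv.symm_apply_apply, hlevel]
    congr 1
    · rw [letters, List.flatMap_map]
      rfl
    · rw [← List.map_coe_finRange_eq_range, List.flatMap_map]
  rw [SLP.encode, List.finRange_succ, List.flatMap_cons, List.flatMap_map]
  simp only [slp, hrules]
  simp only [rhs, Fin.cases_zero, hstart]
  simp [slpString, SLP.encodeVar]

end Reduction.Data

theorem wordValue_append {G : Type u} [Group G] (S : Finset G) (v w : List S) :
    wordValue S (v ++ w) = wordValue S v * wordValue S w := by
  simp [wordValue]

theorem wordValue_flatMap {G : Type u} [Group G] (S : Finset G) {ι : Type*} (l : List ι)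
    (f : ι → List S) : wordValue S (l.flatMap f) = (l.map fun b => wordValue S (f b)).prod := by
  induction l with
  | nil => rfl
  | cons b l ih => rw [List.flatMap_cons, wordValue_append, ih, List.map_cons, List.prod_cons]

namespace Reduction.Data

variable {α : Type u} {H : Type v} [Group H] {S : Finset H} (R : Data α S) (f : Monoid.End H)

/-- The variable for `b` and the power `k` defines `(f ^ k) b`. -/
theorem wordValue_powVar (hf : ∀ b, wordValue S (R.image b) = f b) (x : List α)
    (k : Fin (2 * R.D * x.length + 1)) (b : S) :
    wordValue S ((R.slp x).valVar (R.powVar k b)) = (f ^ (k : ℕ)) b := by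
  induction k using Fin.induction generalizing b with
  | zero =>
    rw [SLP.valVar_eq]
    rw [show (R.slp x).rho = R.rhs x _ from rfl, rhs_powVar]
    simp [levelRhs, wordValue]
  | succ k ih =>
    rw [SLP.valVar_eq]
    rw [show (R.slp x).rho = R.rhs x _ from rfl, rhs_powVar, wordValue_flatMap]
    simp only [levelRhs, Fin.cases_succ, List.map_map, Function.comp_def, Sum.elim_inl, ih]
    rw [Fin.val_succ, pow_succ, Monoid.End.coe_mul, Function.comp_apply, ← hf, wordValue,
      map_list_prod, List.map_map]
    rfl

/-- The group element defined by the straight-line program. -/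
theorem wordValue_slp (hf : ∀ b, wordValue S (R.image b) = f b) (x : List α) :
    wordValue S (R.slp x).val = ((List.range x.length).map fun i =>
      (f ^ R.level x i) (wordValue S (x[i]?.elim [] R.word))).prod := by
  rw [SLP.val, SLP.valVar_eq]
  change wordValue S ((R.startRhs x _).flatMap _) = _
  rw [startRhs, List.flatMap_assoc, wordValue_flatMap]
  congr 1
  refine List.map_congr_left fun i hi => ?_
  rw [List.flatMap_map, wordValue_flatMap, wordValue, map_list_prod, List.map_map]
  congr 1
  refine List.map_congr_left fun b _ => ?_
  rw [Sum.elim_inl, wordValue_powVar R f hf, R.level_ofNat x (List.mem_range.1 hi).le]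
  rfl

end Reduction.Data

/-! ### Words in an ascending HNN-extension -/

theorem IsSymmGenSet.wordValue_surjective {G : Type u} [Group G] {S : Finset G}
    (hS : IsSymmGenSet S) : Function.Surjective (wordValue S) := by
  intro g
  have hg : g ∈ Subgroup.closure (S : Set G) := hS.closure_eq_top ▸ Subgroup.mem_top g
  rw [← Subgroup.mem_toSubmonoid, Subgroup.closure_toSubmonoid] at hg
  obtain ⟨l, hl, rfl⟩ := Submonoid.exists_list_of_mem_closure hg
  have hl' : ∀ a ∈ l, a ∈ S := fun a ha =>
    (hl a ha).elim id fun h => inv_inv a ▸ hS.inv_mem _ h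
  lift l to List S using hl'
  exact ⟨l, rfl⟩

namespace AscendingHNN

variable {H : Type u} [Group H] {B : Subgroup H} (φ : H ≃* B)

/-- The isomorphism onto a subgroup as an endomorphism. -/
def endo : Monoid.End H := B.subtype.comp φ.toMonoidHom

variable {φ}

local notation "τ" => (HNNExtension.t : AscendingHNN H B φ)

theorem of_mul_t (a : H) : (HNNExtension.of a * τ : AscendingHNN H B φ) =
    τ * HNNExtension.of (endo φ a) := by
  rw [show endo φ a = (φ a : H) from rfl, ← conj_eq, mul_assoc, mul_inv_cancel_left]

theorem zpow_neg_mul_of (k : ℕ) (a : H) :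
    (τ ^ (-(k : ℤ)) * HNNExtension.of a : AscendingHNN H B φ) =
      HNNExtension.of ((endo φ ^ k) a) * τ ^ (-(k : ℤ)) := by
  have h : (HNNExtension.of a * τ ^ k : AscendingHNN H B φ) =
      τ ^ k * HNNExtension.of ((endo φ ^ k) a) := by
    induction k with
    | zero => simp
    | succ k ih =>
      rw [pow_succ τ, ← mul_assoc, ih, mul_assoc, of_mul_t, ← mul_assoc, pow_succ' (endo φ)]
      rfl
  rw [zpow_neg, zpow_natCast, inv_mul_eq_iff_eq_mul, ← mul_assoc, ← h, mul_inv_cancel_right]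

/-- Every element `g` can be pushed to the right through a large negative power of `t`, leaving an
element of `H` to the left and changing the power by the exponent sum `d` of `g`. -/
theorem exists_pushRight (g : AscendingHNN H B φ) : ∃ (C : ℕ) (d : ℤ), ∀ k : ℤ, C ≤ k →
    ∃ h : H, τ ^ (-k) * g = HNNExtension.of h * τ ^ (d - k) := by
  induction g using HNNExtension.induction_on with
  | of a =>
    refine ⟨0, 0, fun k hk => ?_⟩
    lift k to ℕ using by simpa using hk
    exact ⟨_, by rw [zpow_neg_mul_of, zero_sub]⟩
  | t =>
    refine ⟨0, 1, fun k _ => ⟨1, ?_⟩⟩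
    rw [map_one, one_mul, sub_eq_neg_add, zpow_add_one]
  | mul g g' hg hg' =>
    obtain ⟨C, d, h1⟩ := hg
    obtain ⟨C', d', h2⟩ := hg'
    refine ⟨C + (C' + d).toNat, d + d', fun k hk => ?_⟩
    push_cast at hk
    obtain ⟨a, ha⟩ := h1 k (by omega)
    obtain ⟨b, hb⟩ := h2 (k - d) (by omega)
    rw [neg_sub] at hb
    refine ⟨a * b, ?_⟩
    rw [← mul_assoc, ha, mul_assoc, hb, map_mul, mul_assoc]
    congr 3
    ring
  | inv g hg =>
    obtain ⟨C, d, h1⟩ := hg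
    refine ⟨(C - d).toNat, -d, fun k hk => ?_⟩
    obtain ⟨a, ha⟩ := h1 (k + d) (by omega)
    refine ⟨a⁻¹, ?_⟩
    have hg : g = τ ^ (k + d) * (HNNExtension.of a * τ ^ (d - (k + d))) := by
      rw [← ha, ← mul_assoc, ← zpow_add, add_neg_cancel, zpow_zero, one_mul]
    rw [hg, map_inv]
    group

/-- The exponent sum of `t`. -/
def exponentSum : AscendingHNN H B φ →* Multiplicative ℤ :=
  HNNExtension.lift 1 (Multiplicative.ofAdd 1) fun _ => by simp

theorem exponentSum_zpow (k : ℤ) : exponentSum (τ ^ k) = Multiplicative.ofAdd k := by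
  rw [map_zpow, exponentSum, HNNExtension.lift_t, ← ofAdd_zsmul, smul_eq_mul, mul_one]

theorem exponentSum_of (a : H) :
    exponentSum (HNNExtension.of a : AscendingHNN H B φ) = 1 := by
  rw [exponentSum, HNNExtension.lift_of, MonoidHom.one_apply]

open Reduction

variable {S : Finset H} {T : Finset (AscendingHNN H B φ)}

/-- Pushing a word to the right through a power of `t` that is large enough for all prefixes. -/
theorem pushRight_word (R : Data T S) (C : ℕ)
    (hR : ∀ g : T, τ ^ (-(C : ℤ)) * (g : AscendingHNN H B φ) =
      HNNExtension.of (wordValue S (R.word g)) * τ ^ (R.d g - C)) (x : List T) {i : ℕ}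
    (hi : i ≤ x.length) :
    τ ^ (-((R.D * x.length + C : ℕ) : ℤ)) * wordValue T (x.take i) =
      HNNExtension.of ((List.range i).map fun q =>
        (endo φ ^ R.level x q) (wordValue S (x[q]?.elim [] R.word))).prod *
      τ ^ (-((R.level x i + C : ℕ) : ℤ)) := by
  induction i with
  | zero =>
    have : R.level x 0 = R.D * x.length := by
      zify; simp [R.level_cast x (Nat.zero_le _), Data.height]
    simp [this, wordValue]
  | succ i ih =>
    have e1 := R.level_cast x (i := i) (by omega)
    have e2 := R.level_cast x hi
    rw [R.height_succ x (by omega)] at e2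
    rw [List.take_succ_eq_append_getElem (by omega), wordValue_append, ← mul_assoc,
      ih (by omega), List.range_succ, List.map_append, List.prod_append, map_mul, mul_assoc,
      mul_assoc]
    congr 1
    have h1 := hR x[i]
    have hx : x[i]? = some x[i] := List.getElem?_eq_getElem _
    rw [show wordValue T [x[i]] = (x[i] : AscendingHNN H B φ) by simp [wordValue],
      Nat.cast_add, neg_add, zpow_add, mul_assoc, h1, ← mul_assoc, zpow_neg_mul_of, mul_assoc,
      ← zpow_add]
    simp only [hx, Option.elim_some, List.map_singleton, List.prod_singleton]
    congr 2
    push_cast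
    omega

/-- A word represents `1` if and only if its exponent sum is `0` and the product of the images
of its letters from `H` is `1`. -/
theorem wordValue_eq_one_iff (R : Data T S) (C : ℕ)
    (hR : ∀ g : T, τ ^ (-(C : ℤ)) * (g : AscendingHNN H B φ) =
      HNNExtension.of (wordValue S (R.word g)) * τ ^ (R.d g - C)) (x : List T) :
    wordValue T x = 1 ↔ R.height x x.length = 0 ∧ ((List.range x.length).map fun q =>
      (endo φ ^ R.level x q) (wordValue S (x[q]?.elim [] R.word))).prod = 1 := by
  have key := pushRight_word R C hR x le_rfl
  rw [List.take_length] at key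
  have hlev := R.level_cast x le_rfl
  have hneg : R.height x x.length = 0 → -((R.level x x.length + C : ℕ) : ℤ) =
      -((R.D * x.length + C : ℕ) : ℤ) := by
    intro h
    push_cast
    linarith
  constructor
  · intro h
    have h0 : R.height x x.length = 0 := by
      have := congrArg exponentSum key
      rw [h, mul_one, map_mul, exponentSum_of, one_mul, exponentSum_zpow, exponentSum_zpow] at this
      have := Multiplicative.ofAdd.injective this
      push_cast at this
      linarith
    rw [h, mul_one, hneg h0, right_eq_mul] at key
    exact ⟨h0, HNNExtension.of_injective _ (key.trans (map_one _).symm)⟩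
  · rintro ⟨h0, h1⟩
    rw [h1, map_one, one_mul, hneg h0, mul_eq_left] at key
    exact key

theorem exists_data (hS : IsSymmGenSet S) (T : Finset (AscendingHNN H B φ)) :
    ∃ (R : Data T S) (C : ℕ), (∀ b, wordValue S (R.image b) = endo φ b) ∧
      ∀ g : T, τ ^ (-(C : ℤ)) * (g : AscendingHNN H B φ) =
        HNNExtension.of (wordValue S (R.word g)) * τ ^ (R.d g - C) := by
  choose c d hcd using fun g : T => exists_pushRight (φ := φ) g
  let C := Finset.univ.sup c
  choose h hh using fun g => hcd g C (by exact_mod_cast Finset.le_sup (Finset.mem_univ g))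
  choose w hw using hS.wordValue_surjective
  refine ⟨{
    card := S.card
    index := S.equivFin
    d := d
    D := Finset.univ.sup fun g => (d g).natAbs
    abs_d_le := fun g => by
      rw [Int.abs_eq_natAbs]
      exact_mod_cast Finset.le_sup (f := fun g => (d g).natAbs) (Finset.mem_univ g)
    word := fun g => w (h g)
    image := fun b => w (endo φ b) }, C, fun b => hw _, fun g => ?_⟩
  rw [hh, hw]

end AscendingHNN

theorem mainTheorem6 {H : Type u} [Group H] [Group.FG H]
    (B : Subgroup H) (φ : H ≃* B)
    (S : Finset H) (hS : IsSymmGenSet S)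
    (T : Finset (AscendingHNN H B φ)) (hT : IsSymmGenSet T) :
    LogspaceReducible (wordProblem T) (compressedWordProblem S) := by
  obtain ⟨R, C, himage, hR⟩ := AscendingHNN.exists_data hS T
  refine ⟨R.output, Reduction.logspaceComputable_output R, fun x => ?_⟩
  change wordValue T x = 1 ↔ _
  rw [AscendingHNN.wordValue_eq_one_iff R C hR, Reduction.Data.output]
  split_ifs with h0
  · rw [← R.encode_slp, encode_mem_compressedWordProblem, R.wordValue_slp _ himage]
    simp [h0]
  · exact iff_of_false (fun h => h0 h.1) nil_notMem_compressedWordProblem
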